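/- **Definitions.** A positive, finite, Lebesgue measurable function $b$ on $(0,\infty)$ is slowly varying, $b\in SV(0,\infty)$, if for each $\varepsilon>0$ the function $t^{\varepsilon}b(t)$ is equivalent to a non-decreasing function and $t^{-\varepsilon}b(t)$ is equivalent to a non-increasing function on $(0,\infty)$; here $f\approx g$ (equivalent) means that each of the two is bounded by a positive constant times the other. Let $(X_0,X_1)$ be a compatible couple, i.e. two (real or complex) Banach spaces continuously embedded in a Hausdorff topological vector space. The space $X_0+X_1$ has the norm $\inf\{\|f_0\|_{X_0}+\|f_1\|_{X_1}: f=f_0+f_1\}$ and $X_0\cap X_1$ has the norm $\max\{\|f\|_{X_0},\|f\|_{X_1}\}$. For $t>0$ put $$K(f,t;X_0,X_1)=\inf\{\|f_0\|_{X_0}+t\|f_1\|_{X_1}: f=f_0+f_1,\ f_i\in X_i\}\quad (f\in X_0+X_1),$$ $$J(f,t;X_0,X_1)=\max\{\|f\|_{X_0},\,t\|f\|_{X_1}\}\quad (f\in X_0\cap X_1).$$ For $1\le q<\infty$ and a positive, finite, measurable weight $v$ on $(0,\infty)$, the space $(X_0,X_1)_{0,q,v;K}$ consists of all $f\in X_0+X_1$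 for which $$\|f\|_{0,q,v;K}=\Big(\int_0^\infty \big(v(t)K(f,t;X_0,X_1)\big)^q\,\frac{dt}{t}\Big)^{1/q}<\infty,$$ and $(X_0,X_1)_{0,q,v;J}$ consists of all $f\in X_0+X_1$ for which $$\|f\|_{0,q,v;J}=\inf_u\Big(\int_0^\infty \big(v(t)J(u(t),t;X_0,X_1)\big)^q\,\frac{dt}{t}\Big)^{1/q}<\infty,$$ where the infimum is over all strongly measurable $u:(0,\infty)\to X_0\cap X_1$ with $f=\int_0^\infty u(s)\,\frac{ds}{s}$ (Bochner integral convergent in $X_0+X_1$), and $\inf\emptyset=\infty$. **Theorem 1.7.** Let $(X_0,X_1)$ be a compatible couple, let $1\le q<\infty$ and $1/q+1/q'=1$. Let $b\in SV(0,\infty)$ satisfy $$\int_0^\infty t^{-1}b^{q}(t)\,dt<\infty .$$ Let $\beta\in SV(0,\infty)$ satisfy $$\int_x^\infty t^{-1}\beta^q(t)\,dt<\infty\ \text{ for all } x>0,\qquad \int_0^\infty t^{-1}\beta^q(t)\,dt=\infty,$$ let $B\in SV(0,\infty)$ be such that $B(x)=b(x)$ for $x\in[1,\infty)$ and $B\approx\beta$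 on $(0,1)$, and put $$A(x)=B^{-q/q'}(x)\int_x^\infty t^{-1}B^q(t)\,dt\qquad (x>0),$$ where $q/q'=0$ if $q=1$. Then $$(X_0,X_1)_{0,q,b;K}=(X_0,X_0+X_1)_{0,q,B;K}=(X_0,X_0+X_1)_{0,q,A;J},$$ that is, the three spaces have the same elements and their norms are equivalent. -/

import Mathlib

open MeasureTheory Set
open scoped ENNReal

/-- `f ≈ g` on the set `s`: each of the two functions is bounded on `s` by a constant multiple of
the other one. -/
def EquivOn (f g : ℝ → ℝ) (s : Set ℝ) : Prop :=
  ∃ c : ℝ, 0 < c ∧ ∀ t ∈ s, f t ≤ c * g t ∧ g t ≤ c * f t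

/-- The class `SV(0,∞)` of slowly varying functions: `b` is positive, finite and Lebesgue measurable
on `(0,∞)` and, for each `ε > 0`, `t ^ ε * b t` is equivalent to a non-decreasing function and
`t ^ (-ε) * b t` is equivalent to a non-increasing function on `(0,∞)`.
Values of `b` outside `(0,∞)` are irrelevant. -/
structure SlowlyVarying (b : ℝ → ℝ) : Prop where
  pos : ∀ t ∈ Ioi (0 : ℝ), 0 < b t
  measurable : AEMeasurable b (volume.restrict (Ioi (0 : ℝ)))
  equiv_monotone : ∀ ε : ℝ, 0 < ε → ∃ g : ℝ → ℝ, MonotoneOn g (Ioi 0) ∧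
    EquivOn (fun t => t ^ ε * b t) g (Ioi 0)
  equiv_antitone : ∀ ε : ℝ, 0 < ε → ∃ g : ℝ → ℝ, AntitoneOn g (Ioi 0) ∧
    EquivOn (fun t => t ^ (-ε) * b t) g (Ioi 0)

/-- A compatible couple: two Banach spaces `X₀`, `X₁` (completeness is assumed where it is used),
both continuously embedded in the Hausdorff topological vector space `𝓧`. -/
structure CompatibleCouple (𝕜 X₀ X₁ 𝓧 : Type*) [RCLike 𝕜]
    [NormedAddCommGroup X₀] [NormedSpace 𝕜 X₀] [NormedAddCommGroup X₁] [NormedSpace 𝕜 X₁]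
    [AddCommGroup 𝓧] [Module 𝕜 𝓧] [TopologicalSpace 𝓧] where
  i₀ : X₀ →L[𝕜] 𝓧
  i₁ : X₁ →L[𝕜] 𝓧
  injective₀ : Function.Injective i₀
  injective₁ : Function.Injective i₁

namespace CompatibleCouple

variable {𝕜 X₀ X₁ 𝓧 : Type*} [RCLike 𝕜]
  [NormedAddCommGroup X₀] [NormedSpace 𝕜 X₀] [NormedAddCommGroup X₁] [NormedSpace 𝕜 X₁]
  [AddCommGroup 𝓧] [Module 𝕜 𝓧] [TopologicalSpace 𝓧] [IsTopologicalAddGroup 𝓧]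

/-- The map `(x₀, x₁) ↦ x₀ + x₁` from `X₀ × X₁`, with the norm `‖x₀‖ + ‖x₁‖`, to `𝓧`. -/
noncomputable def addMap (C : CompatibleCouple 𝕜 X₀ X₁ 𝓧) : WithLp 1 (X₀ × X₁) →L[𝕜] 𝓧 :=
  (C.i₀.coprod C.i₁).comp (WithLp.prodContinuousLinearEquiv 1 𝕜 X₀ X₁ : _ →L[𝕜] X₀ × X₁)

/-- The subspace `X₀ + X₁` of `𝓧`. -/
noncomputable def sumSubmodule (C : CompatibleCouple 𝕜 X₀ X₁ 𝓧) : Submodule 𝕜 𝓧 :=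
  LinearMap.range (C.i₀ : X₀ →ₗ[𝕜] 𝓧) ⊔ LinearMap.range (C.i₁ : X₁ →ₗ[𝕜] 𝓧)

/-- The normed space `X₀ ∩ X₁`: the pairs `(x₀, x₁)` whose components are the same element of `𝓧`,
with the norm `max ‖x₀‖ ‖x₁‖` inherited from the product. -/
abbrev Inter (C : CompatibleCouple 𝕜 X₀ X₁ 𝓧) : Type _ :=
  LinearMap.eqLocus ((C.i₀.comp (ContinuousLinearMap.fst 𝕜 X₀ X₁)) : X₀ × X₁ →ₗ[𝕜] 𝓧)
    ((C.i₁.comp (ContinuousLinearMap.snd 𝕜 X₀ X₁)) : X₀ × X₁ →ₗ[𝕜] 𝓧)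

/-- The space `X₀ + X₁` as a space of its own: the quotient of `X₀ × X₁` by the kernel of
`(x₀, x₁) ↦ x₀ + x₁`. Its norm, the quotient norm, is
`‖f‖ = inf {‖x₀‖ + ‖x₁‖ : f = x₀ + x₁}`. -/
def SumSpace (C : CompatibleCouple 𝕜 X₀ X₁ 𝓧) : Type _ :=
  WithLp 1 (X₀ × X₁) ⧸ LinearMap.ker (C.addMap : WithLp 1 (X₀ × X₁) →ₗ[𝕜] 𝓧)

theorem isClosed_ker_addMap [T2Space 𝓧] (C : CompatibleCouple 𝕜 X₀ X₁ 𝓧) :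
    IsClosed (LinearMap.ker (C.addMap : WithLp 1 (X₀ × X₁) →ₗ[𝕜] 𝓧) :
      Set (WithLp 1 (X₀ × X₁))) :=
  C.addMap.isClosed_ker

noncomputable instance [T2Space 𝓧] (C : CompatibleCouple 𝕜 X₀ X₁ 𝓧) :
    NormedAddCommGroup C.SumSpace :=
  haveI := C.isClosed_ker_addMap
  Submodule.Quotient.normedAddCommGroup
    (LinearMap.ker (C.addMap : WithLp 1 (X₀ × X₁) →ₗ[𝕜] 𝓧))

noncomputable instance [T2Space 𝓧] (C : CompatibleCouple 𝕜 X₀ X₁ 𝓧) :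
    NormedSpace 𝕜 C.SumSpace :=
  Submodule.Quotient.normedSpace (LinearMap.ker (C.addMap : WithLp 1 (X₀ × X₁) →ₗ[𝕜] 𝓧)) 𝕜

/-- `X₀ + X₁` as a real normed space; needed for the Bochner integral. -/
noncomputable instance [T2Space 𝓧] (C : CompatibleCouple 𝕜 X₀ X₁ 𝓧) :
    NormedSpace ℝ C.SumSpace :=
  NormedSpace.restrictScalars ℝ 𝕜 C.SumSpace

instance [T2Space 𝓧] [CompleteSpace X₀] [CompleteSpace X₁] (C : CompatibleCouple 𝕜 X₀ X₁ 𝓧) :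
    CompleteSpace C.SumSpace :=
  Submodule.Quotient.completeSpace (LinearMap.ker (C.addMap : WithLp 1 (X₀ × X₁) →ₗ[𝕜] 𝓧))

/-- The embedding of `X₀ + X₁` in `𝓧`. -/
noncomputable def sumEmb [T2Space 𝓧] (C : CompatibleCouple 𝕜 X₀ X₁ 𝓧) : C.SumSpace →L[𝕜] 𝓧 where
  toLinearMap := (LinearMap.ker (C.addMap : WithLp 1 (X₀ × X₁) →ₗ[𝕜] 𝓧)).liftQ
    (C.addMap : WithLp 1 (X₀ × X₁) →ₗ[𝕜] 𝓧) le_rfl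
  cont := C.addMap.continuous.quotient_lift _

theorem sumEmb_injective [T2Space 𝓧] (C : CompatibleCouple 𝕜 X₀ X₁ 𝓧) :
    Function.Injective C.sumEmb :=
  LinearMap.ker_eq_bot.mp (Submodule.ker_liftQ_eq_bot' _ _ rfl)

/-- The inclusion `X₀ ∩ X₁ ⊆ X₀ + X₁`. -/
noncomputable def interToSum (C : CompatibleCouple 𝕜 X₀ X₁ 𝓧) (x : C.Inter) : C.SumSpace :=
  Submodule.Quotient.mk (WithLp.toLp 1 ((x : X₀ × X₁).1, (0 : X₁)))

/-- The compatible couple `(X₀, X₀ + X₁)`. -/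
noncomputable def withSum [T2Space 𝓧] (C : CompatibleCouple 𝕜 X₀ X₁ 𝓧) :
    CompatibleCouple 𝕜 X₀ C.SumSpace 𝓧 where
  i₀ := C.i₀
  i₁ := C.sumEmb
  injective₀ := C.injective₀
  injective₁ := C.sumEmb_injective

/-- The Peetre functional `K(f,t;X₀,X₁)`, the infimum of `‖f₀‖ + t‖f₁‖` over `f = f₀ + f₁`;
it is `∞` if `f` is not in `X₀ + X₁`. -/
noncomputable def K (C : CompatibleCouple 𝕜 X₀ X₁ 𝓧) (f : 𝓧) (t : ℝ) : ℝ≥0∞ :=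
  ⨅ (p : X₀ × X₁) (_ : C.i₀ p.1 + C.i₁ p.2 = f), ENNReal.ofReal (‖p.1‖ + t * ‖p.2‖)

/-- The Peetre functional `J(f,t;X₀,X₁) = max {‖f‖_{X₀}, t‖f‖_{X₁}}` on `X₀ ∩ X₁`. -/
noncomputable def J (C : CompatibleCouple 𝕜 X₀ X₁ 𝓧) (x : C.Inter) (t : ℝ) : ℝ :=
  max ‖(x : X₀ × X₁).1‖ (t * ‖(x : X₀ × X₁).2‖)

/-- `‖f‖_{θ,q,v;K}`, the `L_q(0,∞)`-norm of `t ^ (-θ - 1/q) * v t * K(f,t)`, where `1/∞ = 0`. -/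
noncomputable def kNorm (C : CompatibleCouple 𝕜 X₀ X₁ 𝓧) (θ : ℝ) (q : ℝ≥0∞) (v : ℝ → ℝ)
    (f : 𝓧) : ℝ≥0∞ :=
  eLpNorm (fun t : ℝ => ENNReal.ofReal (t ^ (-θ - 1 / q.toReal) * v t) * C.K f t) q
    (volume.restrict (Ioi 0))

/-- The space `(X₀,X₁)_{θ,q,v;K}`, as a subset of `𝓧`. -/
def kSpace (C : CompatibleCouple 𝕜 X₀ X₁ 𝓧) (θ : ℝ) (q : ℝ≥0∞) (v : ℝ → ℝ) : Set 𝓧 :=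
  {f | f ∈ C.sumSubmodule ∧ C.kNorm θ q v f < ∞}

/-- `f = ∫_0^∞ u(s) ds/s` with a strongly measurable `u : (0,∞) → X₀ ∩ X₁`, the integral being
a convergent Bochner integral in `X₀ + X₁`. -/
structure Represents [T2Space 𝓧] (C : CompatibleCouple 𝕜 X₀ X₁ 𝓧) (u : ℝ → C.Inter) (f : 𝓧) :
    Prop where
  aestronglyMeasurable : AEStronglyMeasurable u (volume.restrict (Ioi (0 : ℝ)))
  integrable : IntegrableOn (fun s : ℝ => s⁻¹ • C.interToSum (u s)) (Ioi 0)
  eq : C.sumEmb (∫ s in Ioi (0 : ℝ), s⁻¹ • C.interToSum (u s)) = f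

/-- `‖f‖_{θ,q,v;J}`, the infimum over all representations `f = ∫_0^∞ u(s) ds/s` of the
`L_q(0,∞)`-norm of `t ^ (-θ - 1/q) * v t * J(u(t),t)`; it is `∞` if there is no representation. -/
noncomputable def jNorm [T2Space 𝓧] (C : CompatibleCouple 𝕜 X₀ X₁ 𝓧) (θ : ℝ) (q : ℝ≥0∞)
    (v : ℝ → ℝ) (f : 𝓧) : ℝ≥0∞ :=
  ⨅ (u : ℝ → C.Inter) (_ : C.Represents u f),
    eLpNorm (fun t : ℝ => t ^ (-θ - 1 / q.toReal) * v t * C.J (u t) t) q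
      (volume.restrict (Ioi 0))

/-- The space `(X₀,X₁)_{θ,q,v;J}`, as a subset of `𝓧`. -/
def jSpace [T2Space 𝓧] (C : CompatibleCouple 𝕜 X₀ X₁ 𝓧) (θ : ℝ) (q : ℝ≥0∞) (v : ℝ → ℝ) :
    Set 𝓧 :=
  {f | f ∈ C.sumSubmodule ∧ C.jNorm θ q v f < ∞}

end CompatibleCouple

/-- Two spaces `S`, `T` inside `𝓧`, with (extended) norms `M`, `N`, coincide: they have the same
elements and their norms are equivalent. -/
def Coincide {𝓧 : Type*} (S : Set 𝓧) (M : 𝓧 → ℝ≥0∞) (T : Set 𝓧) (N : 𝓧 → ℝ≥0∞) : Prop :=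
  S = T ∧ ∃ c : ℝ, 0 < c ∧
    ∀ f ∈ S, M f ≤ ENNReal.ofReal c * N f ∧ N f ≤ ENNReal.ofReal c * M f

/-!
The couple `(X₀, X₀ + X₁)` sees only what happens for large `t`: its `K`-functional equals
`K(f,t;X₀,X₁)` for `t ≥ 1` and is at most `t K(f,1;X₀,X₁)` for `t ≤ 1`. Since `b ^ q dt/t` is finite
on all of `(0,∞)` and `(t B(t)) ^ q dt/t` is finite near `0`, in both `K`-norms the integral
over `(0,1]` is at most a constant times `K(f,1) ^ q`, and this in turn is controlled by the
integral over `(1,∞)`, where the two integrands agree. This is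
`CompatibleCouple.exists_kNorm_withSum_equiv`.

For the `J`-space put `m = B ^ q dt/t` and `Φ(t) = m(t,∞)`, so that `A = B ^ (1 - q) Φ`.

If `f = ∫ u ds/s`, splitting the integral at `t` gives
`K(f,t) ≤ ∫_{s<t} J(u(s),s) ds/s + ∫_{s>t} (t/s) J(u(s),s) ds/s`
(`CompatibleCouple.K_le_lintegral_add`). Multiplied by `B`, the two terms are bounded in
`L_q(dt/t)` by the norm of `A J(u)`: the first by a Hardy inequality for the measure `m`
(`exists_lintegral_Iio_rpow_le`), the second because `B` is slowly varying and `B ≤ c A`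
(`SlowlyVarying.exists_lintegral_Ioi_le`). Both rest on the Schur test `lintegral_rpow_le_schur`.

Conversely, choose `1 ≤ x₀ < x₁ < ⋯` along which `Φ` halves, and nearly optimal decompositions
`f = g_k + h_k` at `x_{k+1}`, with `g_0 = 0`, which is allowed since `X₀ ⊆ X₀ + X₁`. The differences
`Δ_k = g_{k+1} - g_k` sum to `f`; distributing `Δ_k` over `(x_k, x_{k+1}]` with density proportional
to `B ^ q ds/s` gives a `u` with `A J(u) ≤ C B K(f, x_{k+2})` there, and because `m` of consecutive
intervals halves, this can be compared with the integral of `(B K) ^ q` over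
`(x_{k+2}, x_{k+3}]`. This is `CompatibleCouple.exists_jNorm_le_kNorm`.
-/

/-! ### The Schur test and Hardy's inequality for atomless measures on the line -/

/-- The Schur test for integral operators with nonnegative kernel from `L_q(μ)` to `L_q(ν)`.
It follows from Hölder's inequality in the form
`(∫ k g) ^ q ≤ (∫ k h) ^ (q - 1) ∫ k h ^ (1 - q) g ^ q`, which includes `q = 1`. -/
theorem lintegral_rpow_le_schur {α β : Type*} [MeasurableSpace α] [MeasurableSpace β]
    {μ : Measure α} {ν : Measure β} [SFinite μ] [SFinite ν] {q : ℝ} (hq : 1 ≤ q)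
    {k : β → α → ℝ≥0∞} (hk : Measurable (Function.uncurry k))
    {h : α → ℝ≥0∞} (hh : Measurable h) (h0 : ∀ᵐ s ∂μ, h s ≠ 0) (htop : ∀ᵐ s ∂μ, h s ≠ ∞)
    {w : β → ℝ≥0∞} (hw : Measurable w) {C₁ C₂ : ℝ≥0∞}
    (h₁ : ∀ᵐ t ∂ν, ∫⁻ s, k t s * h s ∂μ ≤ C₁ * w t)
    (h₂ : ∀ᵐ s ∂μ, ∫⁻ t, k t s * w t ^ (q - 1) ∂ν ≤ C₂ * h s ^ (q - 1))
    {g : α → ℝ≥0∞} (hg : AEMeasurable g μ) :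
    ∫⁻ t, (∫⁻ s, k t s * g s ∂μ) ^ q ∂ν ≤ C₁ ^ (q - 1) * C₂ * ∫⁻ s, g s ^ q ∂μ := by
  have hq0 : 0 < q := by linarith
  have hk1 : ∀ t, Measurable (k t) := fun t => hk.of_uncurry_left
  have holder : ∀ᵐ t ∂ν, (∫⁻ s, k t s * g s ∂μ) ^ q ≤
      C₁ ^ (q - 1) * ∫⁻ s, w t ^ (q - 1) * (k t s * (h s ^ (1 - q) * g s ^ q)) ∂μ := by
    filter_upwards [h₁] with t ht
    have e : ∫⁻ s, k t s * g s ∂μ =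
        ∫⁻ s, (k t s * h s) ^ (1 - 1 / q) * (k t s * (h s ^ (1 - q) * g s ^ q)) ^ (1 / q) ∂μ := by
      refine lintegral_congr_ae ?_
      filter_upwards [h0, htop] with s hs0 hst
      have p1 : 0 ≤ 1 / q := by positivity
      have p2 : 0 ≤ 1 - 1 / q := by
        rw [sub_nonneg, div_le_one hq0]; exact hq
      rw [ENNReal.mul_rpow_of_nonneg _ _ p2, ENNReal.mul_rpow_of_nonneg _ _ p1,
        ENNReal.mul_rpow_of_nonneg _ _ p1, ← ENNReal.rpow_mul, ← ENNReal.rpow_mul]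
      have e1 : k t s ^ (1 - 1 / q) * k t s ^ (1 / q) = k t s := by
        rw [← ENNReal.rpow_add_of_nonneg _ _ p2 p1]; simp
      have e2 : h s ^ (1 - 1 / q) * h s ^ ((1 - q) * (1 / q)) = 1 := by
        rw [← ENNReal.rpow_add _ _ hs0 hst]
        have : 1 - 1 / q + (1 - q) * (1 / q) = 0 := by field_simp; ring
        rw [this, ENNReal.rpow_zero]
      have e3 : q * (1 / q) = 1 := by field_simp
      rw [e3, ENNReal.rpow_one]
      calc k t s * g s = (k t s ^ (1 - 1 / q) * k t s ^ (1 / q)) *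
            (h s ^ (1 - 1 / q) * h s ^ ((1 - q) * (1 / q))) * g s := by rw [e1, e2, mul_one]
        _ = _ := by ring
    have p1 : 0 ≤ 1 / q := by positivity
    have p2 : 0 ≤ 1 - 1 / q := by
      rw [sub_nonneg, div_le_one hq0]; exact hq
    have H := ENNReal.lintegral_mul_norm_pow_le (μ := μ) (f := fun s => k t s * h s)
      (g := fun s => k t s * (h s ^ (1 - q) * g s ^ q))
      ((hk1 t).mul hh).aemeasurable
      ((hk1 t).aemeasurable.mul ((hh.pow_const _).aemeasurable.mul (hg.pow_const _)))
      p2 p1 (by ring)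
    rw [← e] at H
    calc (∫⁻ s, k t s * g s ∂μ) ^ q
        ≤ ((∫⁻ s, k t s * h s ∂μ) ^ (1 - 1 / q) *
          (∫⁻ s, k t s * (h s ^ (1 - q) * g s ^ q) ∂μ) ^ (1 / q)) ^ q :=
          ENNReal.rpow_le_rpow H hq0.le
      _ = (∫⁻ s, k t s * h s ∂μ) ^ (q - 1) * ∫⁻ s, k t s * (h s ^ (1 - q) * g s ^ q) ∂μ := by
          rw [ENNReal.mul_rpow_of_nonneg _ _ hq0.le, ← ENNReal.rpow_mul, ← ENNReal.rpow_mul]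
          have e1 : (1 - 1 / q) * q = q - 1 := by field_simp
          have e2 : 1 / q * q = 1 := by field_simp
          rw [e1, e2, ENNReal.rpow_one]
      _ ≤ (C₁ * w t) ^ (q - 1) * ∫⁻ s, k t s * (h s ^ (1 - q) * g s ^ q) ∂μ := by
          gcongr
      _ = _ := by
          rw [ENNReal.mul_rpow_of_nonneg _ _ (by linarith), mul_assoc, lintegral_const_mul'']
          exact ((hk1 t).aemeasurable.mul ((hh.pow_const _).aemeasurable.mul (hg.pow_const _)))
  have hmeas : AEMeasurable (Function.uncurry fun t s =>
      w t ^ (q - 1) * (k t s * (h s ^ (1 - q) * g s ^ q))) (ν.prod μ) := by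
    have a1 : AEMeasurable (fun p : β × α => g p.2) (ν.prod μ) := hg.comp_snd
    have a2 : AEMeasurable (fun p : β × α => k p.1 p.2) (ν.prod μ) := hk.aemeasurable
    have a3 : Measurable (fun p : β × α => w p.1) := hw.comp measurable_fst
    have a4 : Measurable (fun p : β × α => h p.2) := hh.comp measurable_snd
    exact (a3.pow_const _).aemeasurable.mul
      (a2.mul ((a4.pow_const _).aemeasurable.mul (a1.pow_const _)))
  have hL : AEMeasurable (fun t =>
      ∫⁻ s, w t ^ (q - 1) * (k t s * (h s ^ (1 - q) * g s ^ q)) ∂μ) ν :=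
    hmeas.lintegral_prod_right'
  calc ∫⁻ t, (∫⁻ s, k t s * g s ∂μ) ^ q ∂ν
      ≤ ∫⁻ t, C₁ ^ (q - 1) * ∫⁻ s, w t ^ (q - 1) * (k t s * (h s ^ (1 - q) * g s ^ q)) ∂μ ∂ν :=
        lintegral_mono_ae holder
    _ = C₁ ^ (q - 1) * ∫⁻ s, ∫⁻ t, w t ^ (q - 1) * (k t s * (h s ^ (1 - q) * g s ^ q)) ∂ν ∂μ := by
        rw [lintegral_const_mul'' _ hL, lintegral_lintegral_swap hmeas]
    _ ≤ C₁ ^ (q - 1) * ∫⁻ s, C₂ * g s ^ q ∂μ := by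
        refine mul_le_mul_right ?_ _
        refine lintegral_mono_ae ?_
        filter_upwards [h₂, h0, htop] with s hs hs0 hst
        calc ∫⁻ t, w t ^ (q - 1) * (k t s * (h s ^ (1 - q) * g s ^ q)) ∂ν
            = (∫⁻ t, k t s * w t ^ (q - 1) ∂ν) * (h s ^ (1 - q) * g s ^ q) := by
              rw [← lintegral_mul_const]
              · refine lintegral_congr fun t => by ring
              · exact (hk.of_uncurry_right (y := s)).mul (hw.pow_const _)
          _ ≤ (C₂ * h s ^ (q - 1)) * (h s ^ (1 - q) * g s ^ q) := by gcongr
          _ = C₂ * (h s ^ (q - 1) * h s ^ (1 - q)) * g s ^ q := by ring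
          _ = C₂ * g s ^ q := by
              rw [← ENNReal.rpow_add _ _ hs0 hst]
              simp
    _ = _ := by rw [lintegral_const_mul'' _ (hg.pow_const _), mul_assoc]

/-- The image of `m` under its tail function `s ↦ m (Ioi s)` is dominated by Lebesgue measure on
the intervals `[0, r]`. -/
theorem measure_setOf_measure_Ioi_le (m : Measure ℝ) [NullSingletonClass m] (r : ℝ≥0∞) :
    m {s | m (Ioi s) ≤ r} ≤ r := by
  set S := {s | m (Ioi s) ≤ r} with hS
  have hanti : ∀ {f : ℕ → ℝ}, Antitone f → (∀ n, f n ∈ S) → m (⋃ n, Ioi (f n)) ≤ r := by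
    intro f hf hfS
    have : Monotone fun n => Ioi (f n) := fun i j hij => Ioi_subset_Ioi (hf hij)
    rw [this.measure_iUnion]
    exact iSup_le hfS
  have hup : ∀ {x y}, x ∈ S → x ≤ y → y ∈ S := fun {x y} hx hxy =>
    (measure_mono (Ioi_subset_Ioi hxy)).trans hx
  rcases S.eq_empty_or_nonempty with he | hne
  · simp [he]
  by_cases hb : BddBelow S
  · have hsub : S ⊆ Ici (sInf S) := fun x hx => csInf_le hb hx
    refine (measure_mono hsub).trans ?_
    rw [← measure_congr (Ioi_ae_eq_Ici (μ := m) (a := sInf S))]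
    refine le_trans (measure_mono ?_)
      (hanti (f := fun n : ℕ => sInf S + 1 / ((n : ℝ) + 1)) ?_ ?_)
    · intro x hx
      obtain ⟨n, hn⟩ := exists_nat_one_div_lt (sub_pos.2 (mem_Ioi.1 hx))
      exact mem_iUnion.2 ⟨n, by simp only [mem_Ioi]; linarith⟩
    · intro i j hij
      have := Nat.one_div_le_one_div (α := ℝ) hij
      simp only; linarith
    · intro n
      obtain ⟨y, hy, hlt⟩ := exists_lt_of_csInf_lt hne
        (show sInf S < sInf S + 1 / ((n : ℝ) + 1) by
          have := Nat.one_div_pos_of_nat (α := ℝ) (n := n); linarith)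
      exact hup hy hlt.le
  · rw [not_bddBelow_iff] at hb
    refine le_trans (measure_mono ?_) (hanti (f := fun n : ℕ => -(n : ℝ)) ?_ ?_)
    · intro x _
      obtain ⟨n, hn⟩ := exists_nat_gt (-x)
      exact mem_iUnion.2 ⟨n, by simp only [mem_Ioi]; linarith⟩
    · intro i j hij
      simpa using hij
    · intro n
      obtain ⟨y, hy, hlt⟩ := hb (-(n : ℝ))
      exact hup hy hlt.le

theorem lintegral_rpow_Ioc {p T : ℝ} (hp : -1 < p) (hT : 0 ≤ T) :
    ∫⁻ r in Ioc 0 T, ENNReal.ofReal (r ^ p) = ENNReal.ofReal (T ^ (p + 1) / (p + 1)) := by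
  have hi : IntervalIntegrable (fun r : ℝ => r ^ p) volume 0 T :=
    intervalIntegral.intervalIntegrable_rpow' hp
  rw [intervalIntegrable_iff_integrableOn_Ioc_of_le hT] at hi
  rw [← ofReal_integral_eq_lintegral_ofReal hi, ← intervalIntegral.integral_of_le hT,
    integral_rpow (Or.inl hp), Real.zero_rpow (by linarith), sub_zero]
  filter_upwards [ae_restrict_mem measurableSet_Ioc] with r hr
  exact Real.rpow_nonneg hr.1.le _

theorem lintegral_rpow_Ioi {p T : ℝ} (hp : p < -1) (hT : 0 < T) :
    ∫⁻ r in Ioi T, ENNReal.ofReal (r ^ p) = ENNReal.ofReal (-T ^ (p + 1) / (p + 1)) := by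
  rw [← ofReal_integral_eq_lintegral_ofReal (integrableOn_Ioi_rpow_of_lt hp hT),
    integral_Ioi_rpow_of_lt hp hT]
  filter_upwards [ae_restrict_mem measurableSet_Ioi] with r hr
  exact Real.rpow_nonneg (hT.trans hr).le _

section Tail

variable {m : Measure ℝ}

theorem measurable_inv_measure_Ioi : Measurable fun s => (m (Ioi s))⁻¹ :=
  (Antitone.measurable fun _ _ h => measure_mono (Ioi_subset_Ioi h)).inv

theorem measure_lt_inv_tail_le [NullSingletonClass m] {r : ℝ} (hr : 0 < r) :
    m {s | r < ((m (Ioi s))⁻¹).toReal} ≤ ENNReal.ofReal r⁻¹ := by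
  refine (measure_mono ?_).trans (measure_setOf_measure_Ioi_le m _)
  intro s hs
  have h1 : ENNReal.ofReal r ≤ (m (Ioi s))⁻¹ :=
    ENNReal.ofReal_le_of_le_toReal (le_of_lt hs)
  rw [mem_ofPred_eq, ENNReal.ofReal_inv_of_pos hr]
  exact ENNReal.le_inv_iff_le_inv.1 h1

/-- Layer cake formula for a power of `1 / m (Ioi s)`. Where the tail is infinite its inverse is
`0`, both in `ℝ≥0∞` and after `toReal`. -/
theorem lintegral_inv_tail_rpow (hpos : ∀ s, m (Ioi s) ≠ 0) {p : ℝ} (hp : 0 < p) (S : Set ℝ) :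
    ∫⁻ s in S, (m (Ioi s))⁻¹ ^ p ∂m = ENNReal.ofReal p * ∫⁻ r in Ioi (0 : ℝ),
      (m.restrict S) {s | r < ((m (Ioi s))⁻¹).toReal} * ENNReal.ofReal (r ^ (p - 1)) := by
  rw [← lintegral_rpow_eq_lintegral_meas_lt_mul (m.restrict S)
    (Filter.Eventually.of_forall fun s => ENNReal.toReal_nonneg)
    measurable_inv_measure_Ioi.ennreal_toReal.aemeasurable hp]
  refine lintegral_congr fun s => ?_
  rw [← ENNReal.ofReal_rpow_of_nonneg ENNReal.toReal_nonneg hp.le, ENNReal.ofReal_toReal]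
  exact ENNReal.inv_ne_top.2 (hpos s)

/-- The counterpart, for `Φ(s) = m (Ioi s)`, of `∫_{s<t} Φ ^ (-1-a) d(-Φ) ≤ Φ(t) ^ (-a) / a`. -/
theorem lintegral_Iio_inv_tail_rpow_le [NullSingletonClass m] (hpos : ∀ s, m (Ioi s) ≠ 0) {a : ℝ}
    (ha : 0 < a) (t : ℝ) :
    ∫⁻ s in Iio t, (m (Ioi s))⁻¹ ^ (1 + a) ∂m ≤
      ENNReal.ofReal ((1 + a) / a) * (m (Ioi t))⁻¹ ^ a := by
  set T := ((m (Ioi t))⁻¹).toReal with hT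
  have hTt : ENNReal.ofReal T = (m (Ioi t))⁻¹ :=
    ENNReal.ofReal_toReal (ENNReal.inv_ne_top.2 (hpos t))
  have hT0 : 0 ≤ T := ENNReal.toReal_nonneg
  rw [lintegral_inv_tail_rpow hpos (by linarith)]
  have key : ∫⁻ r in Ioi (0 : ℝ), (m.restrict (Iio t)) {s | r < ((m (Ioi s))⁻¹).toReal} *
      ENNReal.ofReal (r ^ (1 + a - 1)) ≤ ∫⁻ r in Ioc 0 T, ENNReal.ofReal (r ^ (a - 1)) := by
    rw [← lintegral_indicator measurableSet_Ioi, ← lintegral_indicator measurableSet_Ioc]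
    refine lintegral_mono fun r => ?_
    by_cases hr : 0 < r
    · rw [indicator_of_mem (mem_Ioi.2 hr)]
      by_cases hrT : r ≤ T
      · rw [indicator_of_mem (mem_Ioc.2 ⟨hr, hrT⟩)]
        calc _ ≤ ENNReal.ofReal r⁻¹ * ENNReal.ofReal (r ^ (1 + a - 1)) := by
              gcongr
              exact (Measure.restrict_apply_le _ _).trans (measure_lt_inv_tail_le hr)
          _ = _ := by
              rw [← ENNReal.ofReal_mul (by positivity), ← Real.rpow_neg_one,
                ← Real.rpow_add hr]
              congr 2; ring
      · have : (m.restrict (Iio t)) {s | r < ((m (Ioi s))⁻¹).toReal} = 0 := by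
          rw [Measure.restrict_apply' measurableSet_Iio]
          convert measure_empty (μ := m)
          rw [eq_empty_iff_forall_notMem]
          rintro s ⟨h1, h2⟩
          refine hrT (le_of_lt (lt_of_lt_of_le (mem_ofPred_eq ▸ h1) ?_))
          refine ENNReal.toReal_mono (ENNReal.inv_ne_top.2 (hpos t)) ?_
          exact ENNReal.inv_le_inv.2 (measure_mono (Ioi_subset_Ioi (le_of_lt h2)))
        rw [this, zero_mul]
        exact zero_le
    · rw [indicator_of_notMem (by simpa using hr)]
      exact zero_le
  calc _ ≤ ENNReal.ofReal (1 + a) * ∫⁻ r in Ioc 0 T, ENNReal.ofReal (r ^ (a - 1)) := by gcongr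
    _ = _ := by
      rw [lintegral_rpow_Ioc (by linarith) hT0, ← hTt, ENNReal.ofReal_rpow_of_nonneg hT0 ha.le,
        ← ENNReal.ofReal_mul (by linarith), ← ENNReal.ofReal_mul (by positivity)]
      congr 1
      rw [sub_add_cancel]; ring

/-- The counterpart, for `Φ(s) = m (Ioi s)`, of `∫_{t>s} Φ ^ (-c) d(-Φ) ≤ Φ(s) ^ (1-c) / (1-c)`. -/
theorem lintegral_Ioi_inv_tail_rpow_le [NullSingletonClass m] (hpos : ∀ s, m (Ioi s) ≠ 0) {c : ℝ}
    (hc0 : 0 ≤ c) (hc1 : c < 1) {s : ℝ} (hs : m (Ioi s) ≠ ∞) :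
    (m (Ioi s))⁻¹ * ∫⁻ t in Ioi s, (m (Ioi t))⁻¹ ^ c ∂m ≤
      ENNReal.ofReal (1 / (1 - c)) * (m (Ioi s))⁻¹ ^ c := by
  rcases hc0.eq_or_lt with rfl | hc
  · simp [ENNReal.inv_mul_cancel (hpos s) hs]
  set T := ((m (Ioi s))⁻¹).toReal with hT
  have hTt : ENNReal.ofReal T = (m (Ioi s))⁻¹ :=
    ENNReal.ofReal_toReal (ENNReal.inv_ne_top.2 (hpos s))
  have hT0 : 0 < T := ENNReal.toReal_pos (ENNReal.inv_ne_zero.2 hs) (ENNReal.inv_ne_top.2 (hpos s))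
  have hTi : m (Ioi s) = ENNReal.ofReal T⁻¹ := by
    rw [ENNReal.ofReal_inv_of_pos hT0, hTt, inv_inv]
  rw [lintegral_inv_tail_rpow hpos hc]
  have key : ∫⁻ r in Ioi (0 : ℝ), (m.restrict (Ioi s)) {s | r < ((m (Ioi s))⁻¹).toReal} *
      ENNReal.ofReal (r ^ (c - 1)) ≤
      ENNReal.ofReal (T⁻¹ * (T ^ c / c)) + ENNReal.ofReal (T ^ (c - 1) / (1 - c)) := by
    rw [← Ioc_union_Ioi_eq_Ioi hT0.le]
    refine (lintegral_union_le _ _ _).trans (add_le_add ?_ ?_)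
    · calc _ ≤ ∫⁻ r in Ioc 0 T, ENNReal.ofReal T⁻¹ * ENNReal.ofReal (r ^ (c - 1)) := by
            refine lintegral_mono fun r => ?_
            gcongr
            rw [← hTi]
            exact (measure_mono (subset_univ _)).trans (by simp)
        _ = _ := by
            rw [lintegral_const_mul' _ _ ENNReal.ofReal_ne_top,
              lintegral_rpow_Ioc (by linarith) hT0.le, ← ENNReal.ofReal_mul (by positivity)]
            simp
    · calc _ ≤ ∫⁻ r in Ioi T, ENNReal.ofReal (r ^ (c - 2)) := by
            refine setLIntegral_mono' measurableSet_Ioi fun r hr => ?_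
            have hr0 : 0 < r := hT0.trans hr
            calc _ ≤ ENNReal.ofReal r⁻¹ * ENNReal.ofReal (r ^ (c - 1)) := by
                  gcongr
                  exact (Measure.restrict_apply_le _ _).trans (measure_lt_inv_tail_le hr0)
              _ = _ := by
                  rw [← ENNReal.ofReal_mul (by positivity), ← Real.rpow_neg_one,
                    ← Real.rpow_add hr0]
                  congr 2; ring
        _ = _ := by
            rw [lintegral_rpow_Ioi (by linarith) hT0]
            congr 1
            have e1 : c - 2 + 1 = c - 1 := by ring
            rw [e1, neg_div, ← div_neg, neg_sub]
  have h1c : 0 < 1 - c := by linarith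
  calc _ ≤ (m (Ioi s))⁻¹ * (ENNReal.ofReal c * (ENNReal.ofReal (T⁻¹ * (T ^ c / c)) +
        ENNReal.ofReal (T ^ (c - 1) / (1 - c)))) := by gcongr
    _ = _ := by
      rw [← hTt, ENNReal.ofReal_rpow_of_nonneg hT0.le hc.le, ← ENNReal.ofReal_add (by positivity)
        (by positivity), ← ENNReal.ofReal_mul hc.le, ← ENNReal.ofReal_mul hT0.le,
        ← ENNReal.ofReal_mul (by positivity)]
      congr 1
      rw [Real.rpow_sub_one hT0.ne']
      field_simp
      ring

/-- **Hardy's inequality** with respect to an atomless measure `m` on the line, the weight being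
the tail `m (Ioi s)`. -/
theorem exists_lintegral_Iio_rpow_le [NullSingletonClass m] [SFinite m] (hpos : ∀ s, m (Ioi s) ≠ 0)
    (hfin : ∀ᵐ s ∂m, m (Ioi s) ≠ ∞) {q : ℝ} (hq : 1 ≤ q) :
    ∃ C : ℝ≥0∞, C ≠ ∞ ∧ ∀ γ : ℝ → ℝ≥0∞, AEMeasurable γ m →
      ∫⁻ t, (∫⁻ s in Iio t, γ s ∂m) ^ q ∂m ≤ C * ∫⁻ s, (m (Ioi s) * γ s) ^ q ∂m := by
  have hq0 : 0 < q := by linarith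
  set a : ℝ := 1 / (2 * q) with ha_def
  have ha : 0 < a := by positivity
  have haq : a * (q - 1) < 1 := by
    rw [ha_def, div_mul_eq_mul_div, div_lt_one (by positivity)]; linarith
  -- The kernel is `Φ(s)⁻¹` for `s < t`, with `Φ(s) = m (Ioi s)`, and it acts on `Φ γ`. The Schur
  -- weight is `Φ ^ (-a)`; any `a` with `0 < a` and `a (q - 1) < 1` works.
  refine ⟨ENNReal.ofReal ((1 + a) / a) ^ (q - 1) * ENNReal.ofReal (1 / (1 - a * (q - 1))),
    ENNReal.mul_ne_top (ENNReal.rpow_ne_top_of_nonneg (by linarith) ENNReal.ofReal_ne_top)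
      ENNReal.ofReal_ne_top, fun γ hγ => ?_⟩
  set Ψ : ℝ → ℝ≥0∞ := fun s => (m (Ioi s))⁻¹ with hΨ
  have hΨm : Measurable Ψ := measurable_inv_measure_Ioi
  have hΦm : Measurable fun s => m (Ioi s) :=
    Antitone.measurable fun _ _ h => measure_mono (Ioi_subset_Ioi h)
  set k : ℝ → ℝ → ℝ≥0∞ := fun t s => (Iio t).indicator Ψ s with hk
  have hkm : Measurable (Function.uncurry k) := by
    have : Function.uncurry k = {p : ℝ × ℝ | p.2 < p.1}.indicator fun p => Ψ p.2 := by
      ext ⟨t, s⟩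
      simp [hk, Function.uncurry, indicator]
    rw [this]
    exact (hΨm.comp measurable_snd).indicator (measurableSet_lt measurable_snd measurable_fst)
  have H := lintegral_rpow_le_schur (μ := m) (ν := m) hq hkm (h := fun s => Ψ s ^ a)
    (hΨm.pow_const _) ?_ ?_ (w := fun s => Ψ s ^ a) (hΨm.pow_const _)
    (C₁ := ENNReal.ofReal ((1 + a) / a)) (C₂ := ENNReal.ofReal (1 / (1 - a * (q - 1)))) ?_ ?_
    (hΦm.aemeasurable.mul hγ)
  · refine le_trans (le_of_eq ?_) H
    refine lintegral_congr fun t => ?_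
    congr 1
    rw [← lintegral_indicator measurableSet_Iio]
    refine lintegral_congr_ae ?_
    filter_upwards [hfin] with s hs
    by_cases hst : s < t
    · simp [hk, hΨ, hst, indicator, ← mul_assoc, ENNReal.inv_mul_cancel (hpos s) hs]
    · simp [hk, hst, indicator]
  · filter_upwards [hfin] with s hs
    simp [ENNReal.rpow_eq_zero_iff, hΨ, hs, ha, hpos s]
  · filter_upwards [hfin] with s hs
    exact ENNReal.rpow_ne_top_of_nonneg ha.le (ENNReal.inv_ne_top.2 (hpos s))
  · refine Filter.Eventually.of_forall fun t => ?_
    refine le_trans (le_of_eq ?_) (lintegral_Iio_inv_tail_rpow_le hpos ha t)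
    rw [← lintegral_indicator measurableSet_Iio]
    refine lintegral_congr fun s => ?_
    by_cases hst : s < t
    · simp only [hk, hΨ, indicator, mem_Iio, hst, if_true]
      rw [ENNReal.rpow_add_of_nonneg _ _ zero_le_one ha.le, ENNReal.rpow_one]
    · simp [hk, hst, indicator]
  · filter_upwards [hfin] with s hs
    have := lintegral_Ioi_inv_tail_rpow_le hpos (mul_nonneg ha.le (sub_nonneg.2 hq)) haq hs
    rw [← ENNReal.rpow_mul]
    refine le_trans (le_of_eq ?_) this
    rw [← lintegral_const_mul _ (measurable_inv_measure_Ioi.pow_const _),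
      ← lintegral_indicator measurableSet_Ioi]
    refine lintegral_congr fun t => ?_
    by_cases hst : s < t
    · simp [hk, hΨ, hst, indicator, ← ENNReal.rpow_mul]
    · simp [hk, hst, indicator]

end Tail

/-! ### The measures `dt/t` and `B ^ q dt/t`, and Hardy inequalities for slowly varying weights -/

theorem exists_measure_Ioi_eq {m : Measure ℝ} [NullSingletonClass m] {a : ℝ} (ha : m (Ioi a) ≠ ∞)
    {r : ℝ≥0∞} (hr0 : r ≠ 0) (hr : r ≤ m (Ioi a)) : ∃ x, a ≤ x ∧ m (Ioi x) = r := by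
  have hrt : r ≠ ∞ := ne_top_of_le_ne_top ha hr
  have hle : ∀ {x}, a ≤ x → m (Ioi x) ≠ ∞ := fun hx =>
    ne_top_of_le_ne_top ha (measure_mono (Ioi_subset_Ioi hx))
  have hcont : ContinuousOn (fun x => m.real (Ioi x)) (Ici a) := by
    have := IntegrableOn.continuousOn_Ici_primitive_Ioi (μ := m) (f := fun _ => (1 : ℝ)) (a₀ := a)
      (integrableOn_const ha)
    simpa using this
  have hlim : Filter.Tendsto (fun n : ℕ => m (Ioi (a + n))) Filter.atTop (nhds 0) := by
    have := tendsto_measure_iInter_atTop (μ := m) (s := fun n : ℕ => Ioi (a + n))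
      (fun n => measurableSet_Ioi.nullMeasurableSet)
      (fun i j hij => Ioi_subset_Ioi (by simpa using hij)) ⟨0, by simpa using ha⟩
    have he : ⋂ n : ℕ, Ioi (a + n) = ∅ := by
      rw [eq_empty_iff_forall_notMem]
      intro x hx
      obtain ⟨n, hn⟩ := exists_nat_gt (x - a)
      have := mem_iInter.1 hx n
      simp only [mem_Ioi] at this
      linarith
    rwa [he, measure_empty] at this
  obtain ⟨n, hn⟩ := (hlim.eventually_lt_const hr0.bot_lt).exists
  have han : a ≤ a + n := by simp
  have hmem : r.toReal ∈ Icc (m.real (Ioi (a + n))) (m.real (Ioi a)) :=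
    ⟨ENNReal.toReal_mono hrt hn.le, ENNReal.toReal_mono ha hr⟩
  obtain ⟨x, hx, hxe⟩ := intermediate_value_Icc' han (hcont.mono Icc_subset_Ici_self) hmem
  exact ⟨x, hx.1, (ENNReal.toReal_eq_toReal_iff' (hle hx.1) hrt).1 hxe⟩

/-- The Haar measure `dt/t` of the multiplicative group `(0,∞)`, as a measure on `ℝ`. -/
noncomputable def logMeasure : Measure ℝ :=
  (volume.restrict (Ioi 0)).withDensity fun t => ENNReal.ofReal t⁻¹

theorem lintegral_logMeasure (F : ℝ → ℝ≥0∞) :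
    ∫⁻ t, F t ∂logMeasure = ∫⁻ t in Ioi 0, ENNReal.ofReal t⁻¹ * F t :=
  lintegral_withDensity_eq_lintegral_mul_non_measurable _ measurable_inv.ennreal_ofReal
    (Filter.Eventually.of_forall fun _ => ENNReal.ofReal_lt_top) F

theorem setLIntegral_logMeasure {S : Set ℝ} (hS : MeasurableSet S) (F : ℝ → ℝ≥0∞) :
    ∫⁻ t in S, F t ∂logMeasure = ∫⁻ t in S ∩ Ioi 0, ENNReal.ofReal t⁻¹ * F t := by
  rw [logMeasure, restrict_withDensity hS, Measure.restrict_restrict hS]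
  exact lintegral_withDensity_eq_lintegral_mul_non_measurable _ measurable_inv.ennreal_ofReal
    (Filter.Eventually.of_forall fun _ => ENNReal.ofReal_lt_top) F

theorem logMeasure_absolutelyContinuous : logMeasure ≪ volume.restrict (Ioi (0 : ℝ)) :=
  withDensity_absolutelyContinuous _ _

theorem absolutelyContinuous_logMeasure : volume.restrict (Ioi (0 : ℝ)) ≪ logMeasure := by
  refine withDensity_absolutelyContinuous' measurable_inv.ennreal_ofReal.aemeasurable ?_
  filter_upwards [ae_restrict_mem measurableSet_Ioi] with t ht
  have : 0 < t⁻¹ := inv_pos.2 ht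
  simpa using ht

theorem ae_logMeasure_pos : ∀ᵐ t ∂logMeasure, 0 < t :=
  logMeasure_absolutelyContinuous.ae_le (ae_restrict_mem measurableSet_Ioi)

instance : SFinite logMeasure := by unfold logMeasure; infer_instance

/-- The measure `B ^ q dt/t` on `(0,∞)`. -/
noncomputable def powerMeasure (B : ℝ → ℝ) (q : ℝ) : Measure ℝ :=
  logMeasure.withDensity fun t => ENNReal.ofReal (B t) ^ q

section

variable {B : ℝ → ℝ} {q : ℝ}

instance : SFinite (powerMeasure B q) := by unfold powerMeasure; infer_instance

instance : NullSingletonClass (powerMeasure B q) :=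
  ⟨fun _ => (withDensity_absolutelyContinuous _ _).trans logMeasure_absolutelyContinuous
    (measure_singleton _)⟩

theorem ae_powerMeasure_pos : ∀ᵐ t ∂powerMeasure B q, 0 < t :=
  (withDensity_absolutelyContinuous _ _).ae_le ae_logMeasure_pos

end

namespace SlowlyVarying

variable {B : ℝ → ℝ}

theorem exists_rpow_mul_le (hB : SlowlyVarying B) {ε : ℝ} (hε : 0 < ε) :
    ∃ c : ℝ, 0 < c ∧ ∀ s t, 0 < s → s ≤ t → s ^ ε * B s ≤ c * (t ^ ε * B t) := by
  obtain ⟨g, hg, c, hc, h⟩ := hB.equiv_monotone ε hε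
  refine ⟨c * c, by positivity, fun s t hs hst => ?_⟩
  have ht : 0 < t := hs.trans_le hst
  calc s ^ ε * B s ≤ c * g s := (h s hs).1
    _ ≤ c * g t := by gcongr; exact hg hs ht hst
    _ ≤ c * (c * (t ^ ε * B t)) := by gcongr; exact (h t ht).2
    _ = _ := by ring

theorem aemeasurable_logMeasure (hB : SlowlyVarying B) : AEMeasurable B logMeasure :=
  hB.measurable.mono_ac logMeasure_absolutelyContinuous

variable {q : ℝ}

theorem aemeasurable_rpow (hB : SlowlyVarying B) :
    AEMeasurable (fun t => ENNReal.ofReal (B t) ^ q) logMeasure :=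
  hB.aemeasurable_logMeasure.ennreal_ofReal.pow_const _

theorem lintegral_powerMeasure (hB : SlowlyVarying B) (hq : 0 ≤ q) (F : ℝ → ℝ≥0∞) :
    ∫⁻ t, F t ∂powerMeasure B q = ∫⁻ t, ENNReal.ofReal (B t) ^ q * F t ∂logMeasure :=
  lintegral_withDensity_eq_lintegral_mul_non_measurable₀ _ hB.aemeasurable_rpow
    (Filter.Eventually.of_forall fun _ =>
      (ENNReal.rpow_ne_top_of_nonneg hq ENNReal.ofReal_ne_top).lt_top) F

theorem powerMeasure_apply (hB : SlowlyVarying B) (hq : 0 ≤ q) {S : Set ℝ}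
    (hS : MeasurableSet S) (hS0 : S ⊆ Ioi 0) :
    powerMeasure B q S = ∫⁻ t in S, ENNReal.ofReal (t⁻¹ * B t ^ q) := by
  rw [powerMeasure, withDensity_apply _ hS, setLIntegral_logMeasure hS,
    inter_eq_self_of_subset_left hS0]
  refine setLIntegral_congr_fun hS fun t ht => ?_
  have ht0 : 0 < t := hS0 ht
  rw [ENNReal.ofReal_rpow_of_nonneg (hB.pos t ht0).le hq, ← ENNReal.ofReal_mul (by positivity)]

/-- `B(x) ^ q` is dominated by `∫_x^∞ B ^ q dt/t`, since `B` is comparable to `B(x)` from below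
on `(x, 2x]`. -/
theorem exists_rpow_le_powerMeasure_Ioi (hB : SlowlyVarying B) (hq : 0 ≤ q) :
    ∃ c : ℝ, 0 < c ∧ ∀ x, 0 < x →
      ENNReal.ofReal (B x) ^ q ≤ ENNReal.ofReal c * powerMeasure B q (Ioi x) := by
  obtain ⟨c, hc, h⟩ := hB.exists_rpow_mul_le one_pos
  refine ⟨2 * (c * 2) ^ q, by positivity, fun x hx => ?_⟩
  have hBx := hB.pos x hx
  have hlow : ∀ t ∈ Ioc x (2 * x), ENNReal.ofReal ((2 * x)⁻¹ * (B x / (c * 2)) ^ q) ≤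
      ENNReal.ofReal (t⁻¹ * B t ^ q) := by
    intro t ht
    have ht0 : 0 < t := hx.trans ht.1
    have hBt := hB.pos t ht0
    refine ENNReal.ofReal_le_ofReal ?_
    gcongr
    · exact ht.2
    · rw [div_le_iff₀ (by positivity)]
      have h1 := h x t hx ht.1.le
      simp only [Real.rpow_one] at h1
      have h2 : c * (t * B t) ≤ c * (2 * x * B t) := by gcongr; exact ht.2
      refine le_of_mul_le_mul_left ?_ hx
      linarith
  have hsub : Ioc x (2 * x) ⊆ Ioi 0 := fun t ht => hx.trans ht.1
  have : ENNReal.ofReal ((2 * x)⁻¹ * (B x / (c * 2)) ^ q * x) ≤ powerMeasure B q (Ioi x) := by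
    calc ENNReal.ofReal ((2 * x)⁻¹ * (B x / (c * 2)) ^ q * x)
        = ∫⁻ t in Ioc x (2 * x), ENNReal.ofReal ((2 * x)⁻¹ * (B x / (c * 2)) ^ q) := by
          rw [setLIntegral_const, Real.volume_Ioc, ← ENNReal.ofReal_mul (by positivity)]
          congr 1; ring
      _ ≤ ∫⁻ t in Ioc x (2 * x), ENNReal.ofReal (t⁻¹ * B t ^ q) :=
          setLIntegral_mono' measurableSet_Ioc hlow
      _ = powerMeasure B q (Ioc x (2 * x)) := (hB.powerMeasure_apply hq measurableSet_Ioc hsub).symm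
      _ ≤ _ := measure_mono Ioc_subset_Ioi_self
  refine le_trans (le_of_eq ?_) (mul_le_mul_right this _)
  rw [ENNReal.ofReal_rpow_of_nonneg hBx.le hq, ← ENNReal.ofReal_mul (by positivity)]
  congr 1
  rw [Real.div_rpow hBx.le (by positivity)]
  field_simp

theorem powerMeasure_Ioi_ne_zero (hB : SlowlyVarying B) (hq : 0 ≤ q) (x : ℝ) :
    powerMeasure B q (Ioi x) ≠ 0 := by
  have key : ∀ y, 0 < y → powerMeasure B q (Ioi y) ≠ 0 := by
    intro y hy h0
    obtain ⟨c, hc, h⟩ := hB.exists_rpow_le_powerMeasure_Ioi hq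
    have := h y hy
    rw [h0, mul_zero, ENNReal.ofReal_rpow_of_nonneg (hB.pos y hy).le hq, nonpos_iff_eq_zero,
      ENNReal.ofReal_eq_zero] at this
    exact absurd this (not_le.2 (Real.rpow_pos_of_pos (hB.pos y hy) _))
  intro h0
  exact key (max x 1) (by positivity)
    (measure_mono_null (Ioi_subset_Ioi (le_max_left _ _)) h0)

/-- The dual Hardy inequality. As `t ^ (1/2) B(t)` is almost increasing, `B(t) t/s` is at most a
multiple of `(t/s) ^ (1/2) B(s)` for `t < s`, and the Schur test applies with constant weights. -/
theorem exists_lintegral_Ioi_le (hB : SlowlyVarying B) (hq : 1 ≤ q) :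
    ∃ C : ℝ≥0∞, C ≠ ∞ ∧ ∀ g : ℝ → ℝ≥0∞, AEMeasurable g logMeasure →
      ∫⁻ t, (ENNReal.ofReal (B t) * ∫⁻ s in Ioi t, ENNReal.ofReal (t / s) * g s ∂logMeasure) ^ q
        ∂logMeasure ≤ C * ∫⁻ s, (ENNReal.ofReal (B s) * g s) ^ q ∂logMeasure := by
  have hq0 : 0 < q := by linarith
  obtain ⟨c, hc, h⟩ := hB.exists_rpow_mul_le (show (0 : ℝ) < 1 / 2 by norm_num)
  refine ⟨ENNReal.ofReal c ^ q * (2 ^ (q - 1) * 2), ?_, fun g hg => ?_⟩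
  · refine ENNReal.mul_ne_top (ENNReal.rpow_ne_top_of_nonneg hq0.le ENNReal.ofReal_ne_top)
      (ENNReal.mul_ne_top (ENNReal.rpow_ne_top_of_nonneg (by linarith) ENNReal.ofNat_ne_top)
      ENNReal.ofNat_ne_top)
  set k : ℝ → ℝ → ℝ≥0∞ := fun t s =>
    (Ioi t).indicator (fun s => ENNReal.ofReal ((t / s) ^ (1 / 2 : ℝ))) s with hk
  have hkm : Measurable (Function.uncurry k) := by
    have : Function.uncurry k = {p : ℝ × ℝ | p.1 < p.2}.indicator
        fun p => ENNReal.ofReal ((p.1 / p.2) ^ (1 / 2 : ℝ)) := by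
      ext ⟨t, s⟩
      simp [hk, Function.uncurry, indicator]
    rw [this]
    exact (((measurable_fst.div measurable_snd).pow_const _).ennreal_ofReal).indicator
      (measurableSet_lt measurable_fst measurable_snd)
  have hG : AEMeasurable (fun s => ENNReal.ofReal (B s) * g s) logMeasure :=
    hB.aemeasurable_logMeasure.ennreal_ofReal.mul hg
  have H := lintegral_rpow_le_schur (μ := logMeasure) (ν := logMeasure) hq hkm (h := fun _ => 1)
    measurable_const (by simp) (by simp) (w := fun _ => 1) measurable_const (C₁ := 2) (C₂ := 2)
    ?_ ?_ hG
  · have hc' : ∀ᵐ t ∂logMeasure, (ENNReal.ofReal (B t) *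
        ∫⁻ s in Ioi t, ENNReal.ofReal (t / s) * g s ∂logMeasure) ^ q ≤
        ENNReal.ofReal c ^ q * (∫⁻ s, k t s * (ENNReal.ofReal (B s) * g s) ∂logMeasure) ^ q := by
      filter_upwards [ae_logMeasure_pos] with t ht
      rw [← ENNReal.mul_rpow_of_nonneg _ _ hq0.le]
      refine ENNReal.rpow_le_rpow ?_ hq0.le
      rw [← lintegral_const_mul' _ _ ENNReal.ofReal_ne_top,
        ← lintegral_const_mul' _ _ ENNReal.ofReal_ne_top, ← lintegral_indicator measurableSet_Ioi]
      refine lintegral_mono fun s => ?_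
      by_cases hst : t < s
      · have hs : 0 < s := ht.trans hst
        simp only [hk, indicator, mem_Ioi, hst, if_true]
        rw [← mul_assoc, ← mul_assoc, ← mul_assoc, ← ENNReal.ofReal_mul (hB.pos t ht).le,
          ← ENNReal.ofReal_mul hc.le, ← ENNReal.ofReal_mul (by positivity)]
        refine mul_le_mul_left (ENNReal.ofReal_le_ofReal ?_) _
        have h1 := h t s ht hst.le
        rw [Real.div_rpow ht.le hs.le]
        have et : t = t ^ (1 / 2 : ℝ) * t ^ (1 / 2 : ℝ) := by
          rw [← Real.rpow_add ht]; norm_num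
        have es : s = s ^ (1 / 2 : ℝ) * s ^ (1 / 2 : ℝ) := by
          rw [← Real.rpow_add hs]; norm_num
        have pt : 0 < t ^ (1 / 2 : ℝ) := by positivity
        have ps : 0 < s ^ (1 / 2 : ℝ) := by positivity
        generalize B t = bt at *
        generalize B s = bs at *
        generalize t ^ (1 / 2 : ℝ) = a at *
        generalize s ^ (1 / 2 : ℝ) = d at *
        rw [et, es]
        calc bt * (a * a / (d * d)) = (a * bt) * (a / (d * d)) := by ring
          _ ≤ (c * (d * bs)) * (a / (d * d)) := by gcongr
          _ = _ := by field_simp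
      · simp [indicator, hst]
    calc _ ≤ ∫⁻ t, ENNReal.ofReal c ^ q *
          (∫⁻ s, k t s * (ENNReal.ofReal (B s) * g s) ∂logMeasure) ^ q ∂logMeasure :=
          lintegral_mono_ae hc'
      _ = ENNReal.ofReal c ^ q * ∫⁻ t,
          (∫⁻ s, k t s * (ENNReal.ofReal (B s) * g s) ∂logMeasure) ^ q ∂logMeasure :=
          lintegral_const_mul' _ _ (ENNReal.rpow_ne_top_of_nonneg hq0.le ENNReal.ofReal_ne_top)
      _ ≤ _ := by rw [mul_assoc]; exact mul_le_mul_right H _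
  · filter_upwards [ae_logMeasure_pos] with t ht
    simp only [mul_one, hk]
    rw [lintegral_indicator measurableSet_Ioi, setLIntegral_logMeasure measurableSet_Ioi,
      inter_eq_self_of_subset_left (Ioi_subset_Ioi ht.le)]
    calc _ = ∫⁻ s in Ioi t, ENNReal.ofReal (t ^ (1 / 2 : ℝ)) *
             ENNReal.ofReal (s ^ (-(3 / 2) : ℝ)) := by
          refine setLIntegral_congr_fun measurableSet_Ioi fun s hs => ?_
          have hs0 : 0 < s := ht.trans hs
          rw [← ENNReal.ofReal_mul (by positivity), ← ENNReal.ofReal_mul (by positivity),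
            Real.div_rpow ht.le hs0.le, show (-(3 / 2) : ℝ) = -1 - 1 / 2 by norm_num,
            Real.rpow_sub hs0, Real.rpow_neg_one]
          congr 1; ring
      _ = ENNReal.ofReal (t ^ (1 / 2 : ℝ)) *
          ENNReal.ofReal (-t ^ (-(3 / 2) + 1 : ℝ) / (-(3 / 2) + 1)) := by
          rw [lintegral_const_mul' _ _ ENNReal.ofReal_ne_top, lintegral_rpow_Ioi (by norm_num) ht]
      _ = ENNReal.ofReal 2 := by
          rw [← ENNReal.ofReal_mul (by positivity), show (-(3 / 2) + 1 : ℝ) = -(1 / 2) by norm_num,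
            Real.rpow_neg ht.le]
          congr 1
          have : 0 < t ^ (1 / 2 : ℝ) := by positivity
          field_simp
      _ ≤ 2 := by simp
  · filter_upwards [ae_logMeasure_pos] with s hs
    simp only [ENNReal.one_rpow, mul_one]
    calc ∫⁻ t, k t s ∂logMeasure
        = ∫⁻ t in Iio s, ENNReal.ofReal ((t / s) ^ (1 / 2 : ℝ)) ∂logMeasure := by
          rw [← lintegral_indicator measurableSet_Iio]
          refine lintegral_congr fun t => ?_
          simp [hk, indicator]
      _ ≤ ∫⁻ t in Iic s, ENNReal.ofReal ((t / s) ^ (1 / 2 : ℝ)) ∂logMeasure :=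
          lintegral_mono_set Iio_subset_Iic_self
      _ = ∫⁻ t in Ioc 0 s, ENNReal.ofReal (s ^ (-(1 / 2) : ℝ)) *
          ENNReal.ofReal (t ^ (-(1 / 2) : ℝ)) := by
          rw [setLIntegral_logMeasure measurableSet_Iic, Iic_inter_Ioi]
          refine setLIntegral_congr_fun measurableSet_Ioc fun t ht => ?_
          have ht0 : 0 < t := ht.1
          rw [← ENNReal.ofReal_mul (by positivity), ← ENNReal.ofReal_mul (by positivity),
            Real.div_rpow ht0.le hs.le, Real.rpow_neg hs.le,
            show (-(1 / 2) : ℝ) = -1 + 1 / 2 by norm_num, Real.rpow_add ht0, Real.rpow_neg_one]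
          congr 1; ring
      _ = ENNReal.ofReal (s ^ (-(1 / 2) : ℝ)) *
          ENNReal.ofReal (s ^ (-(1 / 2) + 1 : ℝ) / (-(1 / 2) + 1)) := by
          rw [lintegral_const_mul' _ _ ENNReal.ofReal_ne_top,
            lintegral_rpow_Ioc (by norm_num) hs.le]
      _ = ENNReal.ofReal 2 := by
          rw [← ENNReal.ofReal_mul (by positivity), show (-(1 / 2) + 1 : ℝ) = (1 / 2) by norm_num,
            Real.rpow_neg hs.le]
          congr 1
          have : 0 < s ^ (1 / 2 : ℝ) := by positivity
          field_simp
      _ ≤ 2 := by simp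

variable {A : ℝ → ℝ}

/-- The weighted estimate behind the inclusion of the `J`-space in the `K`-space, for the
combined Hardy operator and the weight `A = B ^ (1 - q) ∫_x^∞ B ^ q dt/t`. -/
theorem exists_lintegral_add_le (hB : SlowlyVarying B) (hq : 1 ≤ q)
    (hfin : ∀ x, 0 < x → powerMeasure B q (Ioi x) ≠ ∞)
    (hA : ∀ x, 0 < x → ENNReal.ofReal (A x) =
      ENNReal.ofReal (B x) ^ (1 - q) * powerMeasure B q (Ioi x)) :
    ∃ C : ℝ≥0∞, C ≠ ∞ ∧ ∀ g : ℝ → ℝ≥0∞, AEMeasurable g logMeasure →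
      ∫⁻ t, (ENNReal.ofReal (B t) * (∫⁻ s in Iio t, g s ∂logMeasure +
        ∫⁻ s in Ioi t, ENNReal.ofReal (t / s) * g s ∂logMeasure)) ^ q ∂logMeasure ≤
      C * ∫⁻ s, (ENNReal.ofReal (A s) * g s) ^ q ∂logMeasure := by
  have hq0 : 0 < q := by linarith
  obtain ⟨C₁, hC₁, h₁⟩ := exists_lintegral_Iio_rpow_le (m := powerMeasure B q)
    (hB.powerMeasure_Ioi_ne_zero hq0.le)
    (by filter_upwards [ae_powerMeasure_pos] with s hs using hfin s hs) hq
  obtain ⟨C₂, hC₂, h₂⟩ := hB.exists_lintegral_Ioi_le hq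
  obtain ⟨c, hc, hcB⟩ := hB.exists_rpow_le_powerMeasure_Ioi hq0.le
  have hB0 : ∀ t, 0 < t → ENNReal.ofReal (B t) ≠ 0 := fun t ht => by
    simpa using hB.pos t ht
  refine ⟨2 ^ (q - 1) * (C₁ + C₂ * ENNReal.ofReal c ^ q), ?_, fun g hg => ?_⟩
  · refine ENNReal.mul_ne_top (ENNReal.rpow_ne_top_of_nonneg (by linarith) ENNReal.ofNat_ne_top)
      (ENNReal.add_ne_top.2 ⟨hC₁, ENNReal.mul_ne_top hC₂
        (ENNReal.rpow_ne_top_of_nonneg hq0.le ENNReal.ofReal_ne_top)⟩)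
  have hBm : AEMeasurable (fun t => ENNReal.ofReal (B t)) logMeasure :=
    hB.aemeasurable_logMeasure.ennreal_ofReal
  have hlower : ∫⁻ t, (ENNReal.ofReal (B t) * ∫⁻ s in Iio t, g s ∂logMeasure) ^ q ∂logMeasure ≤
      C₁ * ∫⁻ s, (ENNReal.ofReal (A s) * g s) ^ q ∂logMeasure := by
    -- `g ds/s` is `B ^ (-q) g dm`, to which the Hardy inequality for `m = B ^ q ds/s` applies.
    have hγ : AEMeasurable (fun s => ENNReal.ofReal (B s) ^ (-q) * g s) (powerMeasure B q) :=
      ((hBm.pow_const _).mul hg).mono_ac (withDensity_absolutelyContinuous _ _)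
    refine le_trans (le_of_eq ?_) ((h₁ _ hγ).trans (le_of_eq ?_))
    · rw [hB.lintegral_powerMeasure hq0.le]
      refine lintegral_congr fun t => ?_
      rw [ENNReal.mul_rpow_of_nonneg _ _ hq0.le]
      congr 2
      rw [← lintegral_indicator measurableSet_Iio, ← lintegral_indicator measurableSet_Iio,
        hB.lintegral_powerMeasure hq0.le]
      refine lintegral_congr_ae ?_
      filter_upwards [ae_logMeasure_pos] with s hs
      by_cases hst : s < t
      · simp only [indicator, mem_Iio, hst, if_true]
        rw [← mul_assoc, ← ENNReal.rpow_add _ _ (hB0 s hs) ENNReal.ofReal_ne_top]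
        simp
      · simp [indicator, hst]
    · rw [hB.lintegral_powerMeasure hq0.le]
      congr 1
      refine lintegral_congr_ae ?_
      filter_upwards [ae_logMeasure_pos] with s hs
      rw [← ENNReal.mul_rpow_of_nonneg _ _ hq0.le, hA s hs, sub_eq_add_neg,
        ENNReal.rpow_add _ _ (hB0 s hs) ENNReal.ofReal_ne_top, ENNReal.rpow_one]
      congr 1; ring
  -- `B = B ^ (1 - q) B ^ q` and `B ^ q` is dominated by the tail.
  have hBA : ∀ s, 0 < s → ENNReal.ofReal (B s) ≤ ENNReal.ofReal c * ENNReal.ofReal (A s) := by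
    intro s hs
    calc ENNReal.ofReal (B s) = ENNReal.ofReal (B s) ^ (1 - q) * ENNReal.ofReal (B s) ^ q := by
          rw [← ENNReal.rpow_add _ _ (hB0 s hs) ENNReal.ofReal_ne_top]; simp
      _ ≤ ENNReal.ofReal (B s) ^ (1 - q) * (ENNReal.ofReal c * powerMeasure B q (Ioi s)) := by
          gcongr; exact hcB s hs
      _ = _ := by rw [hA s hs]; ring
  have hupper : ∫⁻ t, (ENNReal.ofReal (B t) *
      ∫⁻ s in Ioi t, ENNReal.ofReal (t / s) * g s ∂logMeasure) ^ q ∂logMeasure ≤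
      C₂ * ENNReal.ofReal c ^ q * ∫⁻ s, (ENNReal.ofReal (A s) * g s) ^ q ∂logMeasure := by
    refine (h₂ g hg).trans ?_
    rw [mul_assoc, ← lintegral_const_mul' _ _
      (ENNReal.rpow_ne_top_of_nonneg hq0.le ENNReal.ofReal_ne_top)]
    refine mul_le_mul_right (lintegral_mono_ae ?_) _
    filter_upwards [ae_logMeasure_pos] with s hs
    rw [← ENNReal.mul_rpow_of_nonneg _ _ hq0.le, ← mul_assoc]
    exact ENNReal.rpow_le_rpow (mul_le_mul_left (hBA s hs) _) hq0.le
  have hm1 : AEMeasurable (fun t => (ENNReal.ofReal (B t) *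
      ∫⁻ s in Iio t, g s ∂logMeasure) ^ q) logMeasure := by
    refine (hBm.mul (Measurable.aemeasurable ?_)).pow_const _
    exact Monotone.measurable fun a b hab => lintegral_mono_set (Iio_subset_Iio hab)
  calc _ ≤ ∫⁻ t, 2 ^ (q - 1) * ((ENNReal.ofReal (B t) * ∫⁻ s in Iio t, g s ∂logMeasure) ^ q +
        (ENNReal.ofReal (B t) *
          ∫⁻ s in Ioi t, ENNReal.ofReal (t / s) * g s ∂logMeasure) ^ q) ∂logMeasure := by
        refine lintegral_mono fun t => ?_
        rw [mul_add]
        exact ENNReal.rpow_add_le_mul_rpow_add_rpow _ _ hq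
    _ = 2 ^ (q - 1) * (∫⁻ t, (ENNReal.ofReal (B t) * ∫⁻ s in Iio t, g s ∂logMeasure) ^ q
          ∂logMeasure + ∫⁻ t, (ENNReal.ofReal (B t) *
          ∫⁻ s in Ioi t, ENNReal.ofReal (t / s) * g s ∂logMeasure) ^ q ∂logMeasure) := by
        rw [lintegral_const_mul' _ _
          (ENNReal.rpow_ne_top_of_nonneg (by linarith) ENNReal.ofNat_ne_top),
          lintegral_add_left' hm1]
    _ ≤ _ := by
        rw [mul_assoc, add_mul]
        exact mul_le_mul_right (add_le_add hlower hupper) _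

end SlowlyVarying

/-! ### The functionals `K` and `J`, and the couple `(X₀, X₀ + X₁)` -/

namespace CompatibleCouple

variable {𝕜 X₀ X₁ 𝓧 : Type*} [RCLike 𝕜]
  [NormedAddCommGroup X₀] [NormedSpace 𝕜 X₀] [NormedAddCommGroup X₁] [NormedSpace 𝕜 X₁]
  [AddCommGroup 𝓧] [Module 𝕜 𝓧] [TopologicalSpace 𝓧]

theorem mem_sumSubmodule_iff (C : CompatibleCouple 𝕜 X₀ X₁ 𝓧) {f : 𝓧} :
    f ∈ C.sumSubmodule ↔ ∃ x y, C.i₀ x + C.i₁ y = f := by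
  simp [sumSubmodule, Submodule.mem_sup]

theorem K_le (C : CompatibleCouple 𝕜 X₀ X₁ 𝓧) {x : X₀} {y : X₁} {f : 𝓧}
    (h : C.i₀ x + C.i₁ y = f) (t : ℝ) : C.K f t ≤ ENNReal.ofReal (‖x‖ + t * ‖y‖) :=
  iInf₂_le (x, y) h

theorem K_mono (C : CompatibleCouple 𝕜 X₀ X₁ 𝓧) (f : 𝓧) : Monotone (C.K f) := by
  intro s t hst
  refine le_iInf₂ fun p hp => (C.K_le hp s).trans (ENNReal.ofReal_le_ofReal ?_)
  gcongr

theorem exists_of_K_lt (C : CompatibleCouple 𝕜 X₀ X₁ 𝓧) {f : 𝓧} {t : ℝ} {r : ℝ≥0∞}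
    (h : C.K f t < r) : ∃ x y, C.i₀ x + C.i₁ y = f ∧ ENNReal.ofReal (‖x‖ + t * ‖y‖) < r := by
  simp only [K, iInf_lt_iff] at h
  obtain ⟨p, hp, hlt⟩ := h
  exact ⟨p.1, p.2, hp, hlt⟩

theorem K_ne_top (C : CompatibleCouple 𝕜 X₀ X₁ 𝓧) {f : 𝓧} (hf : f ∈ C.sumSubmodule) (t : ℝ) :
    C.K f t ≠ ∞ := by
  obtain ⟨x, y, h⟩ := C.mem_sumSubmodule_iff.1 hf
  exact ne_top_of_le_ne_top ENNReal.ofReal_ne_top (C.K_le h t)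

theorem K_eq_top (C : CompatibleCouple 𝕜 X₀ X₁ 𝓧) {f : 𝓧} (hf : f ∉ C.sumSubmodule) (t : ℝ) :
    C.K f t = ∞ := by
  by_contra h
  obtain ⟨x, y, h, -⟩ := C.exists_of_K_lt (lt_top_iff_ne_top.2 h)
  exact hf (C.mem_sumSubmodule_iff.2 ⟨x, y, h⟩)

/-- The factor `t ^ (-1/q)` in `kNorm` and `jNorm` turns `dt` into `dt/t`. -/
theorem rpow_weight_mul {q : ℝ} (hq : 0 < q) {t : ℝ} (ht : 0 < t) (v : ℝ) (κ : ℝ≥0∞) :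
    (ENNReal.ofReal (t ^ (-0 - 1 / (ENNReal.ofReal q).toReal) * v) * κ) ^ q =
      ENNReal.ofReal t⁻¹ * (ENNReal.ofReal v * κ) ^ q := by
  rw [ENNReal.toReal_ofReal hq.le, ENNReal.ofReal_mul (by positivity), mul_assoc,
    ENNReal.mul_rpow_of_nonneg _ _ hq.le, ENNReal.ofReal_rpow_of_nonneg (by positivity) hq.le,
    ← Real.rpow_mul ht.le]
  congr 2
  rw [show (-0 - 1 / q) * q = -1 by field_simp; ring, Real.rpow_neg_one]

theorem kNorm_eq (C : CompatibleCouple 𝕜 X₀ X₁ 𝓧) {q : ℝ} (hq : 0 < q) (v : ℝ → ℝ) (f : 𝓧) :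
    C.kNorm 0 (ENNReal.ofReal q) v f =
      (∫⁻ t, (ENNReal.ofReal (v t) * C.K f t) ^ q ∂logMeasure) ^ (1 / q) := by
  rw [kNorm, eLpNorm_eq_lintegral_rpow_enorm_toReal (by simpa using hq) ENNReal.ofReal_ne_top]
  rw [ENNReal.toReal_ofReal hq.le, lintegral_logMeasure]
  congr 1
  refine setLIntegral_congr_fun measurableSet_Ioi fun t ht => ?_
  have := rpow_weight_mul hq (mem_Ioi.1 ht) (v t) (C.K f t)
  rw [ENNReal.toReal_ofReal hq.le] at this
  simpa using this

theorem J_nonneg (C : CompatibleCouple 𝕜 X₀ X₁ 𝓧) (x : C.Inter) (t : ℝ) : 0 ≤ C.J x t :=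
  le_max_of_le_left (norm_nonneg _)

section T2

variable [IsTopologicalAddGroup 𝓧] [T2Space 𝓧]

theorem jNorm_eq (C : CompatibleCouple 𝕜 X₀ X₁ 𝓧) {q : ℝ} (hq : 0 < q) {v : ℝ → ℝ}
    (hv : ∀ t, 0 < t → 0 ≤ v t) (f : 𝓧) :
    C.jNorm 0 (ENNReal.ofReal q) v f = ⨅ (u : ℝ → C.Inter) (_ : C.Represents u f),
      (∫⁻ t, (ENNReal.ofReal (v t) * ENNReal.ofReal (C.J (u t) t)) ^ q ∂logMeasure) ^ (1 / q) := by
  rw [jNorm]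
  refine iInf_congr fun u => iInf_congr fun _ => ?_
  rw [eLpNorm_eq_lintegral_rpow_enorm_toReal (by simpa using hq) ENNReal.ofReal_ne_top]
  rw [ENNReal.toReal_ofReal hq.le, lintegral_logMeasure]
  congr 1
  refine setLIntegral_congr_fun measurableSet_Ioi fun t ht => ?_
  have ht0 : 0 < t := ht
  have h := rpow_weight_mul hq ht0 (v t) (ENNReal.ofReal (C.J (u t) t))
  rw [ENNReal.toReal_ofReal hq.le] at h
  have hvt := hv t ht0
  rw [← h, ← ENNReal.ofReal_mul (by positivity), Real.enorm_eq_ofReal]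
  exact mul_nonneg (by positivity) (C.J_nonneg _ _)

/-- The inclusion `X₀ ⊆ X₀ + X₁`. -/
noncomputable def toSum₀ (C : CompatibleCouple 𝕜 X₀ X₁ 𝓧) : X₀ →L[𝕜] C.SumSpace :=
  LinearMap.mkContinuous
    ((Submodule.mkQ (LinearMap.ker (C.addMap : WithLp 1 (X₀ × X₁) →ₗ[𝕜] 𝓧))).comp
      ((WithLp.linearEquiv 1 𝕜 (X₀ × X₁)).symm.toLinearMap.comp (LinearMap.inl 𝕜 X₀ X₁))) 1
    fun x => by
      refine (Submodule.Quotient.norm_mk_le (S := LinearMap.ker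
        (C.addMap : WithLp 1 (X₀ × X₁) →ₗ[𝕜] 𝓧)) (WithLp.toLp 1 (x, (0 : X₁)))).trans ?_
      simp

/-- The inclusion `X₁ ⊆ X₀ + X₁`. -/
noncomputable def toSum₁ (C : CompatibleCouple 𝕜 X₀ X₁ 𝓧) : X₁ →L[𝕜] C.SumSpace :=
  LinearMap.mkContinuous
    ((Submodule.mkQ (LinearMap.ker (C.addMap : WithLp 1 (X₀ × X₁) →ₗ[𝕜] 𝓧))).comp
      ((WithLp.linearEquiv 1 𝕜 (X₀ × X₁)).symm.toLinearMap.comp (LinearMap.inr 𝕜 X₀ X₁))) 1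
    fun x => by
      refine (Submodule.Quotient.norm_mk_le (S := LinearMap.ker
        (C.addMap : WithLp 1 (X₀ × X₁) →ₗ[𝕜] 𝓧)) (WithLp.toLp 1 ((0 : X₀), x))).trans ?_
      simp

variable (C : CompatibleCouple 𝕜 X₀ X₁ 𝓧)

theorem sumEmb_toSum₀ (x : X₀) : C.sumEmb (C.toSum₀ x) = C.i₀ x := by
  have : C.sumEmb (C.toSum₀ x) = C.addMap (WithLp.toLp 1 (x, (0 : X₁))) := rfl
  rw [this]
  simp [addMap]

theorem sumEmb_toSum₁ (x : X₁) : C.sumEmb (C.toSum₁ x) = C.i₁ x := by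
  have : C.sumEmb (C.toSum₁ x) = C.addMap (WithLp.toLp 1 ((0 : X₀), x)) := rfl
  rw [this]
  simp [addMap]

theorem norm_toSum₀_le (x : X₀) : ‖C.toSum₀ x‖ ≤ ‖x‖ := by
  simpa using (C.toSum₀.le_of_opNorm_le (LinearMap.mkContinuous_norm_le _ zero_le_one _) x)

theorem norm_toSum₁_le (x : X₁) : ‖C.toSum₁ x‖ ≤ ‖x‖ := by
  simpa using (C.toSum₁.le_of_opNorm_le (LinearMap.mkContinuous_norm_le _ zero_le_one _) x)

theorem interToSum_eq_toSum₀ (x : C.Inter) : C.interToSum x = C.toSum₀ (x : X₀ × X₁).1 := rfl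

theorem interToSum_eq_toSum₁ (x : C.Inter) : C.interToSum x = C.toSum₁ (x : X₀ × X₁).2 := by
  refine C.sumEmb_injective ?_
  rw [interToSum_eq_toSum₀, sumEmb_toSum₀, sumEmb_toSum₁]
  exact x.2

/-- The quotient norm of `X₀ + X₁` is the infimum of `‖a‖ + ‖b‖`. -/
theorem exists_toSum_add_eq (y : C.SumSpace) {ε : ℝ} (hε : 0 < ε) :
    ∃ a b, C.toSum₀ a + C.toSum₁ b = y ∧ ‖a‖ + ‖b‖ < ‖y‖ + ε := by
  obtain ⟨p, hp, hlt⟩ := Submodule.Quotient.norm_mk_lt (S := LinearMap.ker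
        (C.addMap : WithLp 1 (X₀ × X₁) →ₗ[𝕜] 𝓧)) y hε
  refine ⟨p.fst, p.snd, ?_, ?_⟩
  · rw [← hp]
    refine C.sumEmb_injective ?_
    rw [map_add, sumEmb_toSum₀, sumEmb_toSum₁]
    exact (show C.addMap p = C.i₀ p.fst + C.i₁ p.snd by simp [addMap]).symm
  · rwa [WithLp.prod_norm_eq_of_L1] at hlt

theorem withSum_sumSubmodule : C.withSum.sumSubmodule = C.sumSubmodule := by
  ext f
  rw [mem_sumSubmodule_iff, mem_sumSubmodule_iff]
  constructor
  · rintro ⟨x, y, h⟩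
    obtain ⟨a, b, hab, -⟩ := C.exists_toSum_add_eq y one_pos
    refine ⟨x + a, b, ?_⟩
    rw [← h, ← hab]
    simp only [withSum, map_add, sumEmb_toSum₀, sumEmb_toSum₁]
    abel
  · rintro ⟨x, y, h⟩
    exact ⟨x, C.toSum₁ y, by rw [← h]; simp only [withSum, sumEmb_toSum₁]⟩

theorem withSum_K_le (f : 𝓧) (t : ℝ) (ht : 0 ≤ t) : C.withSum.K f t ≤ C.K f t := by
  refine le_iInf₂ fun p hp => ?_
  refine (C.withSum.K_le (x := p.1) (y := C.toSum₁ p.2) ?_ t).trans (ENNReal.ofReal_le_ofReal ?_)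
  · simpa only [withSum, sumEmb_toSum₁] using hp
  · gcongr
    exact C.norm_toSum₁_le _

theorem withSum_K_eq (f : 𝓧) {t : ℝ} (ht : 1 ≤ t) : C.withSum.K f t = C.K f t := by
  have ht0 : 0 < t := by linarith
  refine le_antisymm (C.withSum_K_le f t ht0.le) (le_iInf₂ fun p hp => ?_)
  refine ENNReal.le_of_forall_pos_le_add fun ε hε _ => ?_
  obtain ⟨a, b, hab, hlt⟩ := C.exists_toSum_add_eq p.2 (show (0 : ℝ) < ε / t by positivity)
  refine (C.K_le (x := p.1 + a) (y := b) ?_ t).trans ?_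
  · rw [← hp, ← hab]
    simp only [withSum, map_add, sumEmb_toSum₀, sumEmb_toSum₁]
    abel
  · rw [← ENNReal.ofReal_coe_nnreal, ← ENNReal.ofReal_add (by positivity) (by positivity)]
    refine ENNReal.ofReal_le_ofReal ?_
    have h1 : ‖p.1 + a‖ ≤ ‖p.1‖ + t * ‖a‖ := by
      refine (norm_add_le _ _).trans ?_
      gcongr
      exact le_mul_of_one_le_left (norm_nonneg _) ht
    have h2 : t * (‖a‖ + ‖b‖) ≤ t * (‖p.2‖ + ε / t) := by gcongr
    have h3 : t * (ε / t) = ε := by field_simp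
    linarith [mul_add t ‖a‖ ‖b‖, mul_add t ‖p.2‖ (ε / t)]

theorem withSum_K_le_mul (f : 𝓧) {t : ℝ} (ht : 0 < t) :
    C.withSum.K f t ≤ ENNReal.ofReal t * C.K f 1 := by
  have ht' : ENNReal.ofReal t ≠ 0 := by simpa using ht
  conv_rhs => rw [K, ENNReal.mul_iInf_of_ne ht' ENNReal.ofReal_ne_top]
  refine le_iInf fun p => ?_
  rw [ENNReal.mul_iInf_of_ne ht' ENNReal.ofReal_ne_top]
  refine le_iInf fun hp => ?_
  refine (C.withSum.K_le (x := 0) (y := C.toSum₀ p.1 + C.toSum₁ p.2) ?_ t).trans ?_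
  · simpa only [withSum, map_zero, zero_add, map_add, sumEmb_toSum₀, sumEmb_toSum₁] using hp
  · rw [← ENNReal.ofReal_mul ht.le]
    refine ENNReal.ofReal_le_ofReal ?_
    rw [norm_zero, zero_add, one_mul]
    gcongr
    exact (norm_add_le _ _).trans (add_le_add (C.norm_toSum₀_le _) (C.norm_toSum₁_le _))

variable [CompleteSpace X₀] [CompleteSpace X₁]

/-- Splitting `f = ∫ u ds/s` at `t` into an integral in `X₀` and one in `X₁` decomposes `f`. -/
theorem K_le_lintegral_add {u : ℝ → C.Inter} {f : 𝓧} (hu : C.Represents u f) {t : ℝ}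
    (ht : 0 < t) :
    C.K f t ≤ ∫⁻ s in Iio t, ENNReal.ofReal (C.J (u s) s) ∂logMeasure +
      ∫⁻ s in Ioi t, ENNReal.ofReal (t / s) * ENNReal.ofReal (C.J (u s) s) ∂logMeasure := by
  set I₁ := ∫⁻ s in Iio t, ENNReal.ofReal (C.J (u s) s) ∂logMeasure with hI₁
  set I₂ := ∫⁻ s in Ioi t, ENNReal.ofReal (t / s) * ENNReal.ofReal (C.J (u s) s) ∂logMeasure
    with hI₂
  let : NormedSpace ℝ X₀ := NormedSpace.restrictScalars ℝ 𝕜 X₀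
  let : NormedSpace ℝ X₁ := NormedSpace.restrictScalars ℝ 𝕜 X₁
  have hm := hu.aestronglyMeasurable
  have hm₀ : AEStronglyMeasurable (fun s => s⁻¹ • (u s : X₀ × X₁).1)
      (volume.restrict (Ioi (0 : ℝ))) :=
    measurable_inv.aestronglyMeasurable.smul
      ((continuous_fst.comp continuous_subtype_val).comp_aestronglyMeasurable hm)
  have hm₁ : AEStronglyMeasurable (fun s => s⁻¹ • (u s : X₀ × X₁).2)
      (volume.restrict (Ioi (0 : ℝ))) :=
    measurable_inv.aestronglyMeasurable.smul
      ((continuous_snd.comp continuous_subtype_val).comp_aestronglyMeasurable hm)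
  have hb₀ : ∫⁻ s in Ioc 0 t, ‖s⁻¹ • (u s : X₀ × X₁).1‖ₑ ≤ I₁ := by
    rw [hI₁, setLIntegral_logMeasure measurableSet_Iio, Iio_inter_Ioi,
      setLIntegral_congr Ioo_ae_eq_Ioc]
    refine setLIntegral_mono' measurableSet_Ioc fun s hs => ?_
    rw [enorm_smul, Real.enorm_eq_ofReal (inv_nonneg.2 hs.1.le), ← ofReal_norm]
    gcongr
    exact le_max_left _ _
  have hb₁ : ENNReal.ofReal t * ∫⁻ s in Ioi t, ‖s⁻¹ • (u s : X₀ × X₁).2‖ₑ ≤ I₂ := by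
    rw [hI₂, setLIntegral_logMeasure measurableSet_Ioi,
      inter_eq_self_of_subset_left (Ioi_subset_Ioi ht.le),
      ← lintegral_const_mul' _ _ ENNReal.ofReal_ne_top]
    refine setLIntegral_mono' measurableSet_Ioi fun s hs => ?_
    have hs0 : 0 < s := ht.trans hs
    rw [enorm_smul, Real.enorm_eq_ofReal (inv_nonneg.2 hs0.le), ← ofReal_norm,
      ← ENNReal.ofReal_mul (by positivity), ← ENNReal.ofReal_mul (by positivity),
      ← ENNReal.ofReal_mul (by positivity), ← ENNReal.ofReal_mul (by positivity)]
    refine ENNReal.ofReal_le_ofReal ?_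
    calc t * (s⁻¹ * ‖(u s : X₀ × X₁).2‖) = s⁻¹ * (t / s * (s * ‖(u s : X₀ × X₁).2‖)) := by
          field_simp
      _ ≤ _ := by gcongr; exact le_max_right _ _
  rcases eq_or_ne I₁ ∞ with h₁ | h₁
  · simp [h₁]
  rcases eq_or_ne I₂ ∞ with h₂ | h₂
  · simp [h₂]
  have hi₀ : IntegrableOn (fun s => s⁻¹ • (u s : X₀ × X₁).1) (Ioc 0 t) :=
    ⟨hm₀.mono_set Ioc_subset_Ioi_self, lt_of_le_of_lt hb₀ h₁.lt_top⟩
  have hi₁ : IntegrableOn (fun s => s⁻¹ • (u s : X₀ × X₁).2) (Ioi t) := by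
    refine ⟨hm₁.mono_set (Ioi_subset_Ioi ht.le), ?_⟩
    rw [HasFiniteIntegral, lt_top_iff_ne_top]
    intro h
    rw [h, ENNReal.mul_top (by simpa using ht)] at hb₁
    exact h₂ (top_le_iff.1 hb₁)
  set x := ∫ s in Ioc 0 t, s⁻¹ • (u s : X₀ × X₁).1 with hx
  set y := ∫ s in Ioi t, s⁻¹ • (u s : X₀ × X₁).2 with hy
  have hxy : C.i₀ x + C.i₁ y = f := by
    rw [← hu.eq, ← C.sumEmb_toSum₀, ← C.sumEmb_toSum₁, ← map_add]
    congr 1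
    have e₀ : C.toSum₀ x = ∫ s in Ioc 0 t, s⁻¹ • C.interToSum (u s) := by
      rw [hx, ← ContinuousLinearMap.integral_comp_comm _ hi₀]
      refine integral_congr_ae (Filter.Eventually.of_forall fun s => ?_)
      exact map_real_smul C.toSum₀ C.toSum₀.continuous _ _
    have e₁ : C.toSum₁ y = ∫ s in Ioi t, s⁻¹ • C.interToSum (u s) := by
      rw [hy, ← ContinuousLinearMap.integral_comp_comm _ hi₁]
      refine integral_congr_ae (Filter.Eventually.of_forall fun s => ?_)
      simp only [interToSum_eq_toSum₁]
      exact map_real_smul C.toSum₁ C.toSum₁.continuous _ _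
    rw [e₀, e₁, ← Ioc_union_Ioi_eq_Ioi ht.le]
    exact (setIntegral_union Ioc_disjoint_Ioi_same measurableSet_Ioi
      (hu.integrable.mono_set Ioc_subset_Ioi_self)
      (hu.integrable.mono_set (Ioi_subset_Ioi ht.le))).symm
  refine (C.K_le hxy t).trans ?_
  rw [ENNReal.ofReal_add (norm_nonneg _) (by positivity), ENNReal.ofReal_mul ht.le, ofReal_norm,
    ofReal_norm]
  refine add_le_add ((enorm_integral_le_lintegral_enorm _).trans hb₀) (le_trans ?_ hb₁)
  gcongr
  exact enorm_integral_le_lintegral_enorm _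

end T2

end CompatibleCouple

/-! ### From the `J`-norm to the `K`-norm -/

instance : (ae logMeasure).NeBot := by
  rw [ae_neBot]
  intro h
  have := absolutelyContinuous_logMeasure
  rw [h, Measure.absolutelyContinuous_zero_iff, Measure.restrict_eq_zero] at this
  simp at this

namespace CompatibleCouple

variable {𝕜 X₀ X₁ 𝓧 : Type*} [RCLike 𝕜]
  [NormedAddCommGroup X₀] [NormedSpace 𝕜 X₀] [NormedAddCommGroup X₁] [NormedSpace 𝕜 X₁]
  [AddCommGroup 𝓧] [Module 𝕜 𝓧] [TopologicalSpace 𝓧]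

section

variable (C : CompatibleCouple 𝕜 X₀ X₁ 𝓧)

theorem measurable_K (f : 𝓧) : Measurable (C.K f) := (C.K_mono f).measurable

theorem aemeasurable_J {u : ℝ → C.Inter}
    (hu : AEStronglyMeasurable u (volume.restrict (Ioi (0 : ℝ)))) :
    AEMeasurable (fun s => ENNReal.ofReal (C.J (u s) s)) logMeasure := by
  have h₀ := (continuous_fst.comp continuous_subtype_val).comp_aestronglyMeasurable hu
  have h₁ := (continuous_snd.comp continuous_subtype_val).comp_aestronglyMeasurable hu
  have : AEMeasurable (fun s => C.J (u s) s) (volume.restrict (Ioi (0 : ℝ))) :=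
    h₀.norm.aemeasurable.max (aemeasurable_id.mul h₁.norm.aemeasurable)
  exact (this.mono_ac logMeasure_absolutelyContinuous).ennreal_ofReal

variable {q : ℝ} {B : ℝ → ℝ}

theorem mem_sumSubmodule_of_kNorm_ne_top (hB : ∀ t, 0 < t → 0 < B t)
    (hBm : AEMeasurable B logMeasure) (hq : 0 < q) {f : 𝓧}
    (hf : C.kNorm 0 (ENNReal.ofReal q) B f ≠ ∞) : f ∈ C.sumSubmodule := by
  by_contra h
  rw [C.kNorm_eq hq] at hf
  have hfin : ∫⁻ t, (ENNReal.ofReal (B t) * C.K f t) ^ q ∂logMeasure ≠ ∞ := by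
    intro h'
    rw [h', ENNReal.top_rpow_of_pos (by positivity)] at hf
    exact hf rfl
  have hmeas : AEMeasurable (fun t => (ENNReal.ofReal (B t) * C.K f t) ^ q) logMeasure :=
    (hBm.ennreal_ofReal.mul (C.measurable_K f).aemeasurable).pow_const _
  obtain ⟨t, ht, ht0⟩ := ((ae_lt_top' hmeas hfin).and ae_logMeasure_pos).exists
  rw [C.K_eq_top h, ENNReal.mul_top (by simpa using hB t ht0), ENNReal.top_rpow_of_pos hq] at ht
  exact lt_irrefl _ ht

end

variable [IsTopologicalAddGroup 𝓧] [T2Space 𝓧] (C : CompatibleCouple 𝕜 X₀ X₁ 𝓧)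
  {q : ℝ} {B A : ℝ → ℝ}

theorem exists_kNorm_le_jNorm [CompleteSpace X₀] [CompleteSpace X₁] (hB : SlowlyVarying B)
    (hq : 1 ≤ q) (hfin : ∀ x, 0 < x → powerMeasure B q (Ioi x) ≠ ∞) (hA0 : ∀ x, 0 < x → 0 ≤ A x)
    (hA : ∀ x, 0 < x → ENNReal.ofReal (A x) =
      ENNReal.ofReal (B x) ^ (1 - q) * powerMeasure B q (Ioi x)) :
    ∃ c : ℝ≥0∞, c ≠ ∞ ∧ ∀ f : 𝓧,
      C.kNorm 0 (ENNReal.ofReal q) B f ≤ c * C.jNorm 0 (ENNReal.ofReal q) A f := by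
  have hq0 : 0 < q := by linarith
  have hq1 : 0 < 1 / q := by positivity
  obtain ⟨c, hc, h⟩ := hB.exists_lintegral_add_le hq hfin hA
  have hc' : (c + 1) ^ (1 / q) ≠ ∞ :=
    ENNReal.rpow_ne_top_of_nonneg hq1.le (ENNReal.add_ne_top.2 ⟨hc, ENNReal.one_ne_top⟩)
  have hc0 : (c + 1) ^ (1 / q) ≠ 0 := by simp [ENNReal.rpow_eq_zero_iff, hq0.le]
  refine ⟨(c + 1) ^ (1 / q), hc', fun f => ?_⟩
  rw [C.jNorm_eq hq0 hA0, C.kNorm_eq hq0, ENNReal.mul_iInf_of_ne hc0 hc']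
  refine le_iInf fun u => ?_
  rw [ENNReal.mul_iInf_of_ne hc0 hc']
  refine le_iInf fun hu => ?_
  rw [← ENNReal.mul_rpow_of_nonneg _ _ hq1.le]
  refine ENNReal.rpow_le_rpow ?_ hq1.le
  refine le_trans (lintegral_mono_ae ?_) ((h _ (C.aemeasurable_J hu.aestronglyMeasurable)).trans
    (mul_le_mul_left (self_le_add_right c 1) _))
  filter_upwards [ae_logMeasure_pos] with t ht
  gcongr
  exact C.K_le_lintegral_add hu ht

/-- Every `u` for which `A J(u)` has finite `L_q(dt/t)`-norm is integrable in `X₀ + X₁`: the Hardy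
estimates bound its `X₀`-norm on `(0,t)` and its `X₁`-norm on `(t,∞)`, for some `t`. -/
theorem integrableOn_interToSum (hB : SlowlyVarying B)
    (hq : 1 ≤ q) (hfin : ∀ x, 0 < x → powerMeasure B q (Ioi x) ≠ ∞)
    (hA : ∀ x, 0 < x → ENNReal.ofReal (A x) =
      ENNReal.ofReal (B x) ^ (1 - q) * powerMeasure B q (Ioi x))
    {u : ℝ → C.Inter} (hu : AEStronglyMeasurable u (volume.restrict (Ioi (0 : ℝ))))
    (hJ : ∫⁻ t, (ENNReal.ofReal (A t) * ENNReal.ofReal (C.J (u t) t)) ^ q ∂logMeasure ≠ ∞) :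
    IntegrableOn (fun s : ℝ => s⁻¹ • C.interToSum (u s)) (Ioi 0) := by
  have hq0 : 0 < q := by linarith
  obtain ⟨c, hc, h⟩ := hB.exists_lintegral_add_le hq hfin hA
  have hJm := C.aemeasurable_J hu
  have hlt := lt_of_le_of_lt (h _ hJm) (ENNReal.mul_lt_top hc.lt_top hJ.lt_top)
  -- Both parts are finite at a single `t`, and this is enough, since on `Ioi t` the kernel `t / s`
  -- turns `J` into a bound for the norm of `X₁`.
  obtain ⟨t, ht, ht1⟩ : ∃ t, 0 < t ∧ (∫⁻ s in Iio t, ENNReal.ofReal (C.J (u s) s) ∂logMeasure +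
      ∫⁻ s in Ioi t, ENNReal.ofReal (t / s) * ENNReal.ofReal (C.J (u s) s) ∂logMeasure) ≠ ∞ := by
    by_contra! hcon
    have : ∫⁻ _, (∞ : ℝ≥0∞) ∂logMeasure < ∞ := by
      refine lt_of_le_of_lt (lintegral_mono_ae ?_) hlt
      filter_upwards [ae_logMeasure_pos] with t ht
      rw [hcon t ht, ENNReal.mul_top (by simpa using hB.pos t ht), ENNReal.top_rpow_of_pos hq0]
    simp only [lintegral_const] at this
    have h0 : logMeasure univ ≠ 0 := by
      rw [Ne, Measure.measure_univ_eq_zero, ← ae_eq_bot]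
      exact Filter.NeBot.ne inferInstance
    rw [ENNReal.top_mul h0] at this
    exact lt_irrefl _ this
  refine ⟨?_, ?_⟩
  · have hu₀ : AEStronglyMeasurable (fun s => C.interToSum (u s)) (volume.restrict (Ioi (0 : ℝ))) :=
      C.toSum₀.continuous.comp_aestronglyMeasurable
        ((continuous_fst.comp continuous_subtype_val).comp_aestronglyMeasurable hu)
    exact measurable_inv.aestronglyMeasurable.smul hu₀
  rw [HasFiniteIntegral]
  obtain ⟨h₁, h₂⟩ := ENNReal.add_ne_top.1 ht1
  have e : ∫⁻ s in Ioi (0 : ℝ), ‖s⁻¹ • C.interToSum (u s)‖ₑ =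
      ∫⁻ s, ‖C.interToSum (u s)‖ₑ ∂logMeasure := by
    rw [lintegral_logMeasure]
    refine setLIntegral_congr_fun measurableSet_Ioi fun s hs => ?_
    have : 0 ≤ s⁻¹ := inv_nonneg.2 (le_of_lt hs)
    rw [enorm_smul, Real.enorm_eq_ofReal this]
  rw [e, ← lintegral_add_compl _ (measurableSet_Iio (a := t)), compl_Iio]
  refine ENNReal.add_lt_top.2 ⟨?_, ?_⟩
  · refine lt_of_le_of_lt (lintegral_mono fun s => ?_) h₁.lt_top
    rw [← ofReal_norm, interToSum_eq_toSum₀]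
    exact ENNReal.ofReal_le_ofReal ((C.norm_toSum₀_le _).trans (le_max_left _ _))
  · have hsing : logMeasure {t} = 0 := logMeasure_absolutelyContinuous (measure_singleton _)
    have : ∫⁻ s in Ici t, ‖C.interToSum (u s)‖ₑ ∂logMeasure =
        ∫⁻ s in Ioi t, ‖C.interToSum (u s)‖ₑ ∂logMeasure := by
      rw [setLIntegral_congr (Ioi_ae_eq_Ici' hsing)]
    rw [this]
    have hle : ENNReal.ofReal t * ∫⁻ s in Ioi t, ‖C.interToSum (u s)‖ₑ ∂logMeasure ≤
        ∫⁻ s in Ioi t, ENNReal.ofReal (t / s) * ENNReal.ofReal (C.J (u s) s) ∂logMeasure := by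
      rw [← lintegral_const_mul' _ _ ENNReal.ofReal_ne_top]
      refine setLIntegral_mono' measurableSet_Ioi fun s hs => ?_
      have hs0 : 0 < s := ht.trans hs
      rw [← ofReal_norm, ← ENNReal.ofReal_mul ht.le, ← ENNReal.ofReal_mul (by positivity),
        interToSum_eq_toSum₁]
      refine ENNReal.ofReal_le_ofReal ?_
      calc t * ‖C.toSum₁ (u s : X₀ × X₁).2‖ ≤ t * ‖(u s : X₀ × X₁).2‖ := by
            gcongr; exact C.norm_toSum₁_le _
        _ = t / s * (s * ‖(u s : X₀ × X₁).2‖) := by field_simp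
        _ ≤ _ := by gcongr; exact le_max_right _ _
    rw [lt_top_iff_ne_top]
    intro h'
    rw [h', ENNReal.mul_top (by simpa using ht)] at hle
    exact h₂ (top_le_iff.1 hle)

end CompatibleCouple

/-! ### Discretization and nearly optimal decompositions -/

/-- A sequence along which the tail `m (Ioi x)` halves at each step; then the measures of the
intervals between consecutive points also halve. -/
theorem exists_seq_measure_Ioi_halving {m : Measure ℝ} [NullSingletonClass m] {a : ℝ}
    (ha : m (Ioi a) ≠ ∞) (hpos : ∀ s, m (Ioi s) ≠ 0) :
    ∃ x : ℕ → ℝ, (∀ k, a ≤ x k) ∧ StrictMono x ∧ Filter.Tendsto x Filter.atTop Filter.atTop ∧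
      (∀ k, m (Ioi (x k)) = 2 * m (Ioc (x k) (x (k + 1)))) ∧
      ∀ k, m (Ioc (x k) (x (k + 1))) = 2 * m (Ioc (x (k + 1)) (x (k + 2))) := by
  have hex : ∀ k : ℕ, ∃ y, a ≤ y ∧ m (Ioi y) = 2⁻¹ ^ k * m (Ioi a) := by
    intro k
    refine exists_measure_Ioi_eq ha (mul_ne_zero (by simp) (hpos a)) ?_
    exact mul_le_of_le_one_left' (pow_le_one' (by simp) k)
  choose x hax hx using hex
  have hfin : ∀ k, m (Ioi (x k)) ≠ ∞ := fun k =>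
    ne_top_of_le_ne_top ha (measure_mono (Ioi_subset_Ioi (hax k)))
  have hhalf : ∀ k, m (Ioi (x k)) = m (Ioi (x (k + 1))) + m (Ioi (x (k + 1))) := by
    intro k
    rw [hx, hx, pow_succ, ← add_mul, ← mul_add, ENNReal.inv_two_add_inv_two, mul_one]
  have hlt : ∀ k, m (Ioi (x (k + 1))) < m (Ioi (x k)) := by
    intro k
    rw [hhalf k]
    exact ENNReal.lt_add_right (hfin _) (hpos _)
  have hmono : StrictMono x := by
    refine strictMono_nat_of_lt_succ fun k => ?_
    by_contra! h
    exact absurd (measure_mono (μ := m) (Ioi_subset_Ioi h)) (not_le.2 (hlt k))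
  have hIoc : ∀ k, m (Ioc (x k) (x (k + 1))) = m (Ioi (x (k + 1))) := by
    intro k
    have h := measure_union (μ := m) (Ioc_disjoint_Ioi_same (a := x k) (b := x (k + 1)))
      measurableSet_Ioi
    rw [Ioc_union_Ioi_eq_Ioi (hmono k.lt_succ_self).le, hhalf k] at h
    exact ((ENNReal.add_left_inj (hfin _)).1 h).symm
  refine ⟨x, hax, hmono, ?_, ?_, ?_⟩
  · refine Filter.tendsto_atTop_atTop_of_monotone hmono.monotone fun b => ?_
    have hlim : Filter.Tendsto (fun k : ℕ => (2⁻¹ : ℝ≥0∞) ^ k * m (Ioi a)) Filter.atTop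
        (nhds 0) := by
      have := ENNReal.Tendsto.mul_const (b := m (Ioi a))
        (ENNReal.tendsto_pow_atTop_nhds_zero_of_lt_one (r := 2⁻¹) (by simp)) (Or.inr ha)
      simpa using this
    obtain ⟨k, hk⟩ := (hlim.eventually_lt_const (hpos b).bot_lt).exists
    refine ⟨k, ?_⟩
    by_contra! h
    rw [← hx] at hk
    exact absurd (measure_mono (μ := m) (Ioi_subset_Ioi h.le)) (not_le.2 hk)
  · intro k
    rw [hIoc, hhalf k, two_mul]
  · intro k
    rw [hIoc, hIoc, hhalf (k + 1), two_mul]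

namespace CompatibleCouple

variable {𝕜 X₀ X₁ 𝓧 : Type*} [RCLike 𝕜]
  [NormedAddCommGroup X₀] [NormedSpace 𝕜 X₀] [NormedAddCommGroup X₁] [NormedSpace 𝕜 X₁]
  [AddCommGroup 𝓧] [Module 𝕜 𝓧] [TopologicalSpace 𝓧]
  (C : CompatibleCouple 𝕜 X₀ X₁ 𝓧)

variable {q : ℝ} {B : ℝ → ℝ}

/-- If the `K`-norm of `f` is finite, `K(f,t)` is at most of order `B(t)⁻¹`, hence of order
`t ^ (1/2)`. It is used only through `K(f,t) / t → 0`. -/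
theorem exists_K_le_rpow_half (hB : SlowlyVarying B) (hq : 1 ≤ q) {f : 𝓧}
    (hf : C.kNorm 0 (ENNReal.ofReal q) B f ≠ ∞) :
    ∃ L : ℝ, ∀ t, 1 ≤ t → (C.K f t).toReal ≤ L * t ^ (1 / 2 : ℝ) := by
  have hq0 : 0 < q := by linarith
  rw [C.kNorm_eq hq0] at hf
  have hN : ∫⁻ t, (ENNReal.ofReal (B t) * C.K f t) ^ q ∂logMeasure ≠ ∞ := by
    intro h'
    rw [h', ENNReal.top_rpow_of_pos (by positivity)] at hf
    exact hf rfl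
  obtain ⟨c, hc, hcB⟩ := hB.exists_rpow_le_powerMeasure_Ioi hq0.le
  obtain ⟨d, hd, hdB⟩ := hB.exists_rpow_mul_le (show (0 : ℝ) < 1 / 2 by norm_num)
  set N := ∫⁻ t, (ENNReal.ofReal (B t) * C.K f t) ^ q ∂logMeasure with hN_def
  set R := (ENNReal.ofReal c * N) ^ (1 / q) with hR
  have hRt : R ≠ ∞ := ENNReal.rpow_ne_top_of_nonneg (by positivity)
    (ENNReal.mul_ne_top ENNReal.ofReal_ne_top hN)
  have key : ∀ t, 0 < t → ENNReal.ofReal (B t) * C.K f t ≤ R := by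
    intro t ht
    rw [hR, one_div, ENNReal.le_rpow_inv_iff hq0, ENNReal.mul_rpow_of_nonneg _ _ hq0.le]
    calc ENNReal.ofReal (B t) ^ q * C.K f t ^ q
        ≤ ENNReal.ofReal c * powerMeasure B q (Ioi t) * C.K f t ^ q := by gcongr; exact hcB t ht
      _ = ENNReal.ofReal c * ∫⁻ s in Ioi t, C.K f t ^ q ∂powerMeasure B q := by
          rw [setLIntegral_const]; ring
      _ ≤ ENNReal.ofReal c * ∫⁻ s in Ioi t, C.K f s ^ q ∂powerMeasure B q := by
          refine mul_le_mul_right (setLIntegral_mono' measurableSet_Ioi fun s hs => ?_) _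
          exact ENNReal.rpow_le_rpow (C.K_mono f (le_of_lt hs)) hq0.le
      _ ≤ ENNReal.ofReal c * ∫⁻ s, C.K f s ^ q ∂powerMeasure B q :=
          mul_le_mul_right (setLIntegral_le_lintegral _ _) _
      _ = ENNReal.ofReal c * N := by
          rw [hB.lintegral_powerMeasure hq0.le]
          simp only [hN_def, ENNReal.mul_rpow_of_nonneg _ _ hq0.le]
  refine ⟨R.toReal * d / B 1, fun t ht => ?_⟩
  have ht0 : 0 < t := by linarith
  have hBt := hB.pos t ht0
  have hB1 := hB.pos 1 (mem_Ioi.2 one_pos)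
  have h1 : B t * (C.K f t).toReal ≤ R.toReal := by
    have := ENNReal.toReal_mono hRt (key t ht0)
    rwa [ENNReal.toReal_mul, ENNReal.toReal_ofReal hBt.le] at this
  have h2 := hdB 1 t one_pos ht
  rw [Real.one_rpow, one_mul] at h2
  have hκ : 0 ≤ (C.K f t).toReal := ENNReal.toReal_nonneg
  rw [div_mul_eq_mul_div, le_div_iff₀ hB1]
  calc (C.K f t).toReal * B 1 ≤ (C.K f t).toReal * (d * (t ^ (1 / 2 : ℝ) * B t)) := by gcongr
    _ = (B t * (C.K f t).toReal) * (d * t ^ (1 / 2 : ℝ)) := by ring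
    _ ≤ R.toReal * (d * t ^ (1 / 2 : ℝ)) := by gcongr
    _ = _ := by ring

/-- Decompositions of `f` that are optimal up to a constant factor at the points `x k`, the first of
them trivial. This needs `X₀ ⊆ X₁`. -/
theorem exists_near_optimal
    (hincl : ∀ x y, ∃ z, C.i₁ z = C.i₀ x + C.i₁ y ∧ ‖z‖ ≤ ‖x‖ + ‖y‖) {f : 𝓧} (hf0 : f ≠ 0)
    (hf : f ∈ C.sumSubmodule) {x : ℕ → ℝ} (hx : ∀ k, 1 ≤ x k) :
    ∃ (g : ℕ → X₀) (h : ℕ → X₁), g 0 = 0 ∧ (∀ k, C.i₀ (g k) + C.i₁ (h k) = f) ∧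
      ∀ k, ‖g k‖ + x k * ‖h k‖ ≤ max 2 (x 0) * (C.K f (x k)).toReal := by
  obtain ⟨x₀, y₀, hxy⟩ := C.mem_sumSubmodule_iff.1 hf
  obtain ⟨z, hz, -⟩ := hincl x₀ y₀
  rw [hxy] at hz
  have hzK : ENNReal.ofReal ‖z‖ ≤ C.K f 1 := by
    refine le_iInf₂ fun p hp => ENNReal.ofReal_le_ofReal ?_
    obtain ⟨z', hz', hle⟩ := hincl p.1 p.2
    have : z' = z := C.injective₁ (by rw [hz', hp, hz])
    rw [this] at hle
    simpa using hle
  have hz0 : z ≠ 0 := by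
    rintro rfl
    exact hf0 (by rw [← hz, map_zero])
  have hKt : ∀ t, C.K f t ≠ ∞ := C.K_ne_top hf
  have hκ : ∀ t, 1 ≤ t → ‖z‖ ≤ (C.K f t).toReal := fun t ht => by
    rw [← ENNReal.ofReal_le_iff_le_toReal (hKt t)]
    exact hzK.trans (C.K_mono f ht)
  -- The constant `2` is for the nearly optimal decompositions, `x 0` for the trivial one.
  have hstep : ∀ k, ∃ p : X₀ × X₁, (k = 0 → p.1 = 0) ∧ C.i₀ p.1 + C.i₁ p.2 = f ∧
      ‖p.1‖ + x k * ‖p.2‖ ≤ max 2 (x 0) * (C.K f (x k)).toReal := by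
    intro k
    rcases Nat.eq_zero_or_pos k with rfl | hk
    · refine ⟨(0, z), fun _ => rfl, by simpa using hz, ?_⟩
      have h1 := hκ (x 0) (hx 0)
      have h2 := hx 0
      rw [norm_zero, zero_add]
      exact mul_le_mul (le_max_right _ _) h1 (norm_nonneg _) (by positivity)
    · have hpos : 0 < (C.K f (x k)).toReal := (norm_pos_iff.2 hz0).trans_le (hκ _ (hx k))
      have hlt : C.K f (x k) < ENNReal.ofReal (2 * (C.K f (x k)).toReal) := by
        rw [ENNReal.lt_ofReal_iff_toReal_lt (hKt _)]
        linarith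
      obtain ⟨p, r, hpr, hlt'⟩ := C.exists_of_K_lt hlt
      refine ⟨(p, r), fun h => absurd h hk.ne', hpr, ?_⟩
      have hx0 := hx k
      rw [ENNReal.ofReal_lt_ofReal_iff_of_nonneg (by positivity)] at hlt'
      refine hlt'.le.trans ?_
      gcongr
      exact le_max_left _ _
  choose p hp0 hp hle using hstep
  exact ⟨fun k => (p k).1, fun k => (p k).2, hp0 0 rfl, hp, hle⟩

variable [IsTopologicalAddGroup 𝓧] [T2Space 𝓧]

theorem interToSum_smul (a : 𝕜) (x : C.Inter) : C.interToSum (a • x) = a • C.interToSum x := by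
  rw [interToSum_eq_toSum₀, interToSum_eq_toSum₀, ← map_smul]
  rfl

/-- The telescoping series `∑ (g (k + 1) - g k)` written as an integral: its `k`-th term is spread
over `(x k, x (k + 1)]` with density `a k * v` with respect to `ds/s`. -/
theorem exists_represents [CompleteSpace X₀] [CompleteSpace X₁] {x : ℕ → ℝ} (hx0 : 0 < x 0)
    (hx : StrictMono x) (hxt : Filter.Tendsto x Filter.atTop Filter.atTop) {v : ℝ → ℝ}
    (hv : AEMeasurable v (volume.restrict (Ioi (0 : ℝ)))) {a : ℕ → ℝ}
    (hav : ∀ k, a k * ∫ s in Ioc (x k) (x (k + 1)), s⁻¹ * v s = 1)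
    {f : 𝓧} {g : ℕ → X₀} {h : ℕ → X₁} (hgh : ∀ k, C.i₀ (g k) + C.i₁ (h k) = f) (hg0 : g 0 = 0)
    (hh : Filter.Tendsto h Filter.atTop (nhds 0)) {Δ : ℕ → C.Inter}
    (hΔ : ∀ k, (Δ k : X₀ × X₁).1 = g (k + 1) - g k) :
    ∃ u : ℝ → C.Inter, AEStronglyMeasurable u (volume.restrict (Ioi (0 : ℝ))) ∧
      (∀ s ≤ x 0, u s = 0) ∧
      (∀ k, ∀ s ∈ Ioc (x k) (x (k + 1)), u s = (v s : 𝕜) • (a k : 𝕜) • Δ k) ∧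
      (IntegrableOn (fun s : ℝ => s⁻¹ • C.interToSum (u s)) (Ioi 0) → C.Represents u f) := by
  classical
  have hex : ∀ s : ℝ, ∃ k, s ≤ x (k + 1) := fun s => by
    obtain ⟨k, hk⟩ := (hxt.eventually_ge_atTop s).exists
    exact ⟨k, hk.trans (hx k.lt_succ_self).le⟩
  -- `idx s` is the number of the interval that contains `s`, if `x 0 < s`.
  set idx : ℝ → ℕ := fun s => Nat.find (hex s) with hidx
  have hidx_eq : ∀ k, ∀ s ∈ Ioc (x k) (x (k + 1)), idx s = k := by
    intro k s hs
    rw [hidx, Nat.find_eq_iff]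
    refine ⟨hs.2, fun n hn => not_le.2 (lt_of_le_of_lt (hx.monotone ?_) hs.1)⟩
    exact hn
  have hidx_m : Measurable idx := measurable_find hex fun k => measurableSet_Iic
  have hunion : ⋃ k, Ioc (x k) (x (k + 1)) = Ioi (x 0) := by
    refine Subset.antisymm (iUnion_subset fun k s hs => ?_) fun s hs => ?_
    · exact lt_of_le_of_lt (hx.monotone (Nat.zero_le k)) hs.1
    · refine mem_iUnion.2 ⟨idx s, ?_, Nat.find_spec (hex s)⟩
      rcases Nat.eq_zero_or_pos (idx s) with h0 | h0
      · rw [h0]; exact hs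
      · have := Nat.find_min (hex s) (m := idx s - 1) (Nat.sub_lt h0 one_pos)
        rwa [show idx s - 1 + 1 = idx s by omega, not_le] at this
  set u : ℝ → C.Inter := (Ioi (x 0)).indicator
    fun s => (v s : 𝕜) • (a (idx s) : 𝕜) • Δ (idx s) with hu
  have hu_zero : ∀ s ≤ x 0, u s = 0 := fun s hs => by
    rw [hu, indicator_of_notMem (by simpa using hs)]
  have hu_eq : ∀ k, ∀ s ∈ Ioc (x k) (x (k + 1)), u s = (v s : 𝕜) • (a k : 𝕜) • Δ k := by
    intro k s hs
    rw [hu, indicator_of_mem (hunion ▸ mem_iUnion.2 ⟨k, hs⟩), hidx_eq k s hs]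
  have hum : AEStronglyMeasurable u (volume.restrict (Ioi (0 : ℝ))) := by
    refine AEStronglyMeasurable.indicator ?_ measurableSet_Ioi
    have h₁ : AEStronglyMeasurable (fun s => (v s : 𝕜)) (volume.restrict (Ioi (0 : ℝ))) :=
      RCLike.continuous_ofReal.comp_aestronglyMeasurable hv.aestronglyMeasurable
    have h₂ : StronglyMeasurable fun s => (a (idx s) : 𝕜) • Δ (idx s) :=
      (StronglyMeasurable.of_discrete (f := fun k : ℕ => (a k : 𝕜) • Δ k)).comp_measurable hidx_m
    exact h₁.smul h₂.aestronglyMeasurable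
  refine ⟨u, hum, hu_zero, hu_eq, fun hint => ⟨hum, hint, ?_⟩⟩
  obtain ⟨F, hF⟩ : ∃ F, C.sumEmb F = f := ⟨C.toSum₀ (g 0) + C.toSum₁ (h 0), by
    rw [map_add, sumEmb_toSum₀, sumEmb_toSum₁, hgh]⟩
  rw [← hF]
  congr 1
  have hsub : Ioi (x 0) ⊆ Ioi 0 := Ioi_subset_Ioi hx0.le
  have hset : ∫ s in Ioi (0 : ℝ), s⁻¹ • C.interToSum (u s) =
      ∫ s in Ioi (x 0), s⁻¹ • C.interToSum (u s) := by
    refine setIntegral_eq_of_subset_of_forall_sdiff_eq_zero measurableSet_Ioi hsub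
      fun s hs => ?_
    rw [hu_zero s (not_lt.1 hs.2), interToSum_eq_toSum₀]
    simp
  have hsum := hasSum_integral_iUnion (μ := volume) (f := fun s : ℝ => s⁻¹ • C.interToSum (u s))
    (s := fun k => Ioc (x k) (x (k + 1))) (fun k => measurableSet_Ioc)
    hx.monotone.pairwise_disjoint_on_Ioc_succ (by rw [hunion]; exact hint.mono_set hsub)
  rw [hunion, ← hset] at hsum
  have hpiece : ∀ k, ∫ s in Ioc (x k) (x (k + 1)), s⁻¹ • C.interToSum (u s) =
      C.toSum₀ (g (k + 1)) - C.toSum₀ (g k) := by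
    intro k
    calc ∫ s in Ioc (x k) (x (k + 1)), s⁻¹ • C.interToSum (u s)
        = ∫ s in Ioc (x k) (x (k + 1)), (s⁻¹ * v s) • (a k • C.interToSum (Δ k)) := by
          refine setIntegral_congr_fun measurableSet_Ioc fun s hs => ?_
          simp only [hu_eq k s hs, interToSum_smul, mul_smul]
          rfl
      _ = C.interToSum (Δ k) := by
          rw [integral_smul_const, smul_smul, mul_comm, hav k, one_smul]
      _ = _ := by rw [interToSum_eq_toSum₀, hΔ, map_sub]
  simp only [hpiece] at hsum
  refine tendsto_nhds_unique hsum.tendsto_sum_nat ?_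
  have hpart : ∀ n, ∑ k ∈ Finset.range n, (C.toSum₀ (g (k + 1)) - C.toSum₀ (g k)) =
      F - C.toSum₁ (h n) := by
    intro n
    rw [Finset.sum_range_sub (fun k => C.toSum₀ (g k)), hg0, map_zero, sub_zero, eq_sub_iff_add_eq]
    refine C.sumEmb_injective ?_
    rw [map_add, sumEmb_toSum₀, sumEmb_toSum₁, hgh, hF]
  simp only [hpart]
  have := (C.toSum₁.continuous.tendsto 0).comp hh
  simpa using tendsto_const_nhds.sub this

end CompatibleCouple

/-! ### From the `K`-norm to the `J`-norm -/

namespace CompatibleCouple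

variable {𝕜 X₀ X₁ 𝓧 : Type*} [RCLike 𝕜]
  [NormedAddCommGroup X₀] [NormedSpace 𝕜 X₀] [NormedAddCommGroup X₁] [NormedSpace 𝕜 X₁]
  [AddCommGroup 𝓧] [Module 𝕜 𝓧] [TopologicalSpace 𝓧]
  (C : CompatibleCouple 𝕜 X₀ X₁ 𝓧) {q : ℝ} {B : ℝ → ℝ}

theorem tendsto_zero_of_norm_add_le (hB : SlowlyVarying B) (hq : 1 ≤ q) {f : 𝓧}
    (hf : C.kNorm 0 (ENNReal.ofReal q) B f ≠ ∞) {x : ℕ → ℝ} (hx : ∀ k, 1 ≤ x k)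
    (hxt : Filter.Tendsto x Filter.atTop Filter.atTop) {g : ℕ → X₀} {h : ℕ → X₁} {M : ℝ}
    (hM : 0 ≤ M) (hgh : ∀ k, ‖g k‖ + x k * ‖h k‖ ≤ M * (C.K f (x k)).toReal) :
    Filter.Tendsto h Filter.atTop (nhds 0) := by
  obtain ⟨L, hL⟩ := C.exists_K_le_rpow_half hB hq hf
  have hlim : Filter.Tendsto (fun k => M * L * x k ^ (-(1 / 2) : ℝ)) Filter.atTop (nhds 0) := by
    have := ((tendsto_rpow_neg_atTop (show (0 : ℝ) < 1 / 2 by norm_num)).comp hxt).const_mul (M * L)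
    simpa using this
  refine squeeze_zero_norm (fun k => ?_) hlim
  have hx0 : 0 < x k := by linarith [hx k]
  have h1 := hgh k
  have h2 : M * (C.K f (x k)).toReal ≤ M * (L * x k ^ (1 / 2 : ℝ)) := by gcongr; exact hL _ (hx k)
  have h3 : x k * x k ^ (-(1 / 2) : ℝ) = x k ^ (1 / 2 : ℝ) := by
    rw [← Real.rpow_one_add' hx0.le (by norm_num)]; norm_num
  refine le_of_mul_le_mul_left ?_ hx0
  calc x k * ‖h k‖ ≤ M * (L * x k ^ (1 / 2 : ℝ)) := by linarith [norm_nonneg (g k)]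
    _ = _ := by rw [← h3]; ring

variable [IsTopologicalAddGroup 𝓧] [T2Space 𝓧] {A : ℝ → ℝ}

theorem jNorm_zero (hq : 0 < q) (hA0 : ∀ x, 0 < x → 0 ≤ A x) :
    C.jNorm 0 (ENNReal.ofReal q) A 0 = 0 := by
  have hz : ∀ s : ℝ, s⁻¹ • C.interToSum 0 = 0 := fun s => by
    rw [interToSum_eq_toSum₀]; simp
  have hrep : C.Represents (fun _ => 0) 0 := by
    refine ⟨aestronglyMeasurable_const, ?_, ?_⟩
    · simp only [hz]; exact integrableOn_zero
    · simp [hz]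
  rw [C.jNorm_eq hq hA0, ← nonpos_iff_eq_zero]
  refine (iInf₂_le (fun _ => 0) hrep).trans (le_of_eq ?_)
  simp [J, hq]

/-- The `K`-space is contained in the `J`-space for ordered couples. The pieces `g (k + 1) - g k` of
`f` live on the interval to the left of the two points at which the decompositions are optimal, so
that `s ‖·‖_{X₁}` stays bounded by `K(f, x (k + 2))` there. -/
theorem exists_jNorm_le_kNorm [CompleteSpace X₀] [CompleteSpace X₁] (hB : SlowlyVarying B)
    (hq : 1 ≤ q) (hfin : ∀ x, 0 < x → powerMeasure B q (Ioi x) ≠ ∞) (hA0 : ∀ x, 0 < x → 0 ≤ A x)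
    (hA : ∀ x, 0 < x → ENNReal.ofReal (A x) =
      ENNReal.ofReal (B x) ^ (1 - q) * powerMeasure B q (Ioi x))
    (hincl : ∀ x y, ∃ z, C.i₁ z = C.i₀ x + C.i₁ y ∧ ‖z‖ ≤ ‖x‖ + ‖y‖) :
    ∃ c : ℝ≥0∞, c ≠ ∞ ∧ ∀ f : 𝓧,
      C.jNorm 0 (ENNReal.ofReal q) A f ≤ c * C.kNorm 0 (ENNReal.ofReal q) B f := by
  have hq0 : 0 < q := by linarith
  have hq1 : 0 < 1 / q := by positivity
  set m := powerMeasure B q with hm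
  have hpos : ∀ s, m (Ioi s) ≠ 0 := hB.powerMeasure_Ioi_ne_zero hq0.le
  obtain ⟨x, hx1, hx, hxt, hdouble, hhalf⟩ :=
    exists_seq_measure_Ioi_halving (hfin 1 one_pos) hpos
  have hx0 : ∀ k, 0 < x k := fun k => by linarith [hx1 k]
  set I : ℕ → Set ℝ := fun k => Ioc (x k) (x (k + 1)) with hI
  have hmI0 : ∀ k, m (I k) ≠ 0 := fun k h => hpos (x k) (by
    rw [hdouble k, show m (Ioc (x k) (x (k + 1))) = 0 from h, mul_zero])
  have hmIt : ∀ k, m (I k) ≠ ∞ := fun k =>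
    ne_top_of_le_ne_top (hfin (x k) (hx0 k)) (measure_mono Ioc_subset_Ioi_self)
  set M : ℝ := max 2 (x 1) with hM
  have hM0 : 0 < M := lt_of_lt_of_le two_pos (le_max_left _ _)
  set D : ℝ≥0∞ := ENNReal.ofReal (2 * M) * 2 with hD
  have hDt : D ≠ ∞ := ENNReal.mul_ne_top ENNReal.ofReal_ne_top ENNReal.ofNat_ne_top
  have hD0 : D ≠ 0 := mul_ne_zero (by simpa using hM0) (by simp)
  have hDq : D ^ q ≠ ∞ := ENNReal.rpow_ne_top_of_nonneg hq0.le hDt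
  have hDq0 : D ^ q ≠ 0 := by simp [ENNReal.rpow_eq_zero_iff, hD0, hDt]
  have hct : (D ^ q * 4) ^ (1 / q) ≠ ∞ :=
    ENNReal.rpow_ne_top_of_nonneg hq1.le (ENNReal.mul_ne_top hDq ENNReal.ofNat_ne_top)
  have hc0 : (D ^ q * 4) ^ (1 / q) ≠ 0 := by
    rw [Ne, ENNReal.rpow_eq_zero_iff_of_pos hq1]
    exact mul_ne_zero hDq0 (by simp)
  refine ⟨(D ^ q * 4) ^ (1 / q), hct, fun f => ?_⟩
  rcases eq_or_ne (C.kNorm 0 (ENNReal.ofReal q) B f) ∞ with hkt | hkt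
  · rw [hkt, ENNReal.mul_top hc0]; exact le_top
  -- Decompositions optimal up to a factor are only sure to exist where `K(f,t) ≠ 0`.
  rcases eq_or_ne f 0 with rfl | hf0
  · rw [C.jNorm_zero hq0 hA0]; exact zero_le
  have hfs : f ∈ C.sumSubmodule :=
    C.mem_sumSubmodule_of_kNorm_ne_top hB.pos hB.aemeasurable_logMeasure hq0 hkt
  have hKt : ∀ t, C.K f t ≠ ∞ := C.K_ne_top hfs
  obtain ⟨g, h, hg0, hgh, hle⟩ := C.exists_near_optimal hincl hf0 hfs (x := fun k => x (k + 1))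
    (fun k => hx1 _)
  have hh : Filter.Tendsto h Filter.atTop (nhds 0) :=
    C.tendsto_zero_of_norm_add_le hB hq hkt (fun k => hx1 _)
      (hxt.comp (Filter.tendsto_add_atTop_nat 1)) hM0.le hle
  have hle₀ : ∀ k, ‖g k‖ ≤ M * (C.K f (x (k + 1))).toReal := fun k => by
    have := hle k
    have h0 : 0 ≤ x (k + 1) * ‖h k‖ := mul_nonneg (hx0 _).le (norm_nonneg _)
    linarith
  have hle₁ : ∀ k, x (k + 1) * ‖h k‖ ≤ M * (C.K f (x (k + 1))).toReal := fun k => by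
    have := hle k
    linarith [norm_nonneg (g k)]
  have hKmono : ∀ k, M * (C.K f (x (k + 1))).toReal ≤ M * (C.K f (x (k + 2))).toReal := fun k => by
    gcongr
    · exact hKt _
    · exact C.K_mono f (hx (Nat.lt_succ_self _)).le
  set Δ : ℕ → C.Inter := fun k => ⟨(g (k + 1) - g k, h k - h (k + 1)), by
    simp only [LinearMap.mem_eqLocus, ContinuousLinearMap.coe_coe, ContinuousLinearMap.comp_apply,
      ContinuousLinearMap.coe_fst', ContinuousLinearMap.coe_snd', map_sub]
    rw [sub_eq_sub_iff_add_eq_add, hgh, add_comm, hgh]⟩ with hΔ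
  have hJΔ : ∀ k, ∀ s ∈ I k, C.J (Δ k) s ≤ 2 * M * (C.K f (x (k + 2))).toReal := by
    intro k s hs
    have hs0 : 0 < s := (hx0 k).trans hs.1
    refine max_le ?_ ?_
    · have h1 : ‖g (k + 1) - g k‖ ≤ ‖g (k + 1)‖ + ‖g k‖ := norm_sub_le _ _
      linarith [hle₀ k, hle₀ (k + 1), hKmono k]
    · have h1 : s * ‖h k - h (k + 1)‖ ≤ x (k + 1) * ‖h k‖ + x (k + 2) * ‖h (k + 1)‖ := by
        calc s * ‖h k - h (k + 1)‖ ≤ s * (‖h k‖ + ‖h (k + 1)‖) := by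
              gcongr; exact norm_sub_le _ _
          _ = s * ‖h k‖ + s * ‖h (k + 1)‖ := mul_add _ _ _
          _ ≤ _ := by
              gcongr
              · exact hs.2
              · exact hs.2.trans (hx (Nat.lt_succ_self _)).le
      have h2 := hle₁ (k + 1)
      rw [show k + 1 + 1 = k + 2 from rfl] at h2
      linarith [hle₁ k, hKmono k]
  have hBq : AEMeasurable (fun s => B s ^ q) (volume.restrict (Ioi (0 : ℝ))) :=
    hB.measurable.pow_const _
  have hIsub : ∀ k, I k ⊆ Ioi 0 := fun k s hs => (hx0 k).trans hs.1
  have hmreal : ∀ k, ∫ s in I k, s⁻¹ * B s ^ q = m.real (I k) := by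
    intro k
    rw [integral_eq_lintegral_of_nonneg_ae, Measure.real, hm,
      hB.powerMeasure_apply hq0.le measurableSet_Ioc (hIsub k)]
    · filter_upwards [ae_restrict_mem measurableSet_Ioc] with s hs
      have hs0 : 0 < s := hIsub k hs
      have := hB.pos s hs0
      positivity
    · exact ((measurable_inv.aemeasurable.mul hBq).mono_measure
        (Measure.restrict_mono (hIsub k) le_rfl)).aestronglyMeasurable
  have hmreal0 : ∀ k, 0 < m.real (I k) := fun k => ENNReal.toReal_pos (hmI0 k) (hmIt k)
  obtain ⟨u, hum, hu_zero, hu_eq, hrep⟩ := C.exists_represents (hx0 0) hx hxt hBq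
    (a := fun k => (m.real (I k))⁻¹)
    (fun k => by rw [hmreal k]; exact inv_mul_cancel₀ (hmreal0 k).ne') hgh hg0 hh (Δ := Δ)
    (fun k => rfl)
  have hpoint : ∀ k, ∀ s ∈ I k, ENNReal.ofReal (A s) * ENNReal.ofReal (C.J (u s) s) ≤
      D * (ENNReal.ofReal (B s) * C.K f (x (k + 2))) := by
    intro k s hs
    have hs0 : 0 < s := hIsub k hs
    have hBs := hB.pos s hs0
    have hJ : C.J (u s) s = B s ^ q * ((m.real (I k))⁻¹ * C.J (Δ k) s) := by
      have hBs' : 0 ≤ B s ^ q := by positivity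
      have ha : 0 ≤ (m.real (I k))⁻¹ := inv_nonneg.2 (hmreal0 k).le
      rw [hu_eq k s hs]
      simp only [J, SetLike.val_smul, Prod.smul_fst, Prod.smul_snd, norm_smul,
        RCLike.norm_ofReal, abs_of_nonneg hBs', abs_of_nonneg ha]
      rw [mul_max_of_nonneg _ _ ha, mul_max_of_nonneg _ _ hBs']
      congr 1; ring
    have ha : ENNReal.ofReal (m.real (I k))⁻¹ = (m (I k))⁻¹ := by
      rw [ENNReal.ofReal_inv_of_pos (hmreal0 k), Measure.real, ENNReal.ofReal_toReal (hmIt k)]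
    have hK : ENNReal.ofReal (C.J (Δ k) s) ≤ ENNReal.ofReal (2 * M) * C.K f (x (k + 2)) := by
      refine (ENNReal.ofReal_le_ofReal (hJΔ k s hs)).trans ?_
      rw [ENNReal.ofReal_mul (by positivity), ENNReal.ofReal_toReal (hKt _)]
    have hΦ : m (Ioi s) * (m (I k))⁻¹ ≤ 2 := by
      calc m (Ioi s) * (m (I k))⁻¹ ≤ 2 * m (I k) * (m (I k))⁻¹ := by
            gcongr
            exact (measure_mono (Ioi_subset_Ioi hs.1.le)).trans (hdouble k).le
        _ = 2 := by rw [mul_assoc, ENNReal.mul_inv_cancel (hmI0 k) (hmIt k), mul_one]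
    have hBB : ENNReal.ofReal (B s) ^ (1 - q) * ENNReal.ofReal (B s) ^ q =
        ENNReal.ofReal (B s) := by
      rw [← ENNReal.rpow_add _ _ (by simpa using hBs) ENNReal.ofReal_ne_top]; simp
    rw [hJ, ENNReal.ofReal_mul (by positivity),
      ENNReal.ofReal_mul (inv_nonneg.2 (hmreal0 k).le), ha, hA s hs0,
      ← ENNReal.ofReal_rpow_of_nonneg hBs.le hq0.le]
    calc ENNReal.ofReal (B s) ^ (1 - q) * m (Ioi s) *
          (ENNReal.ofReal (B s) ^ q * ((m (I k))⁻¹ * ENNReal.ofReal (C.J (Δ k) s)))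
        = (ENNReal.ofReal (B s) ^ (1 - q) * ENNReal.ofReal (B s) ^ q) *
          (m (Ioi s) * (m (I k))⁻¹) * ENNReal.ofReal (C.J (Δ k) s) := by ring
      _ ≤ ENNReal.ofReal (B s) * 2 * (ENNReal.ofReal (2 * M) * C.K f (x (k + 2))) := by
          rw [hBB]; gcongr
      _ = _ := by rw [hD]; ring
  have hpiece : ∀ k, ∫⁻ s in I k, (ENNReal.ofReal (A s) * ENNReal.ofReal (C.J (u s) s)) ^ q
      ∂logMeasure ≤ D ^ q * 4 * ∫⁻ s in I (k + 2), C.K f s ^ q ∂m := by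
    intro k
    calc _ ≤ ∫⁻ s in I k, D ^ q * C.K f (x (k + 2)) ^ q * ENNReal.ofReal (B s) ^ q
          ∂logMeasure := by
          refine setLIntegral_mono' measurableSet_Ioc fun s hs => ?_
          refine (ENNReal.rpow_le_rpow (hpoint k s hs) hq0.le).trans (le_of_eq ?_)
          rw [ENNReal.mul_rpow_of_nonneg D _ hq0.le,
            ENNReal.mul_rpow_of_nonneg (ENNReal.ofReal (B s)) _ hq0.le]
          ring
      _ = D ^ q * C.K f (x (k + 2)) ^ q * m (I k) := by
          rw [lintegral_const_mul' _ _ (ENNReal.mul_ne_top hDq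
            (ENNReal.rpow_ne_top_of_nonneg hq0.le (hKt _))), hm, powerMeasure,
            withDensity_apply _ measurableSet_Ioc]
      -- The factor `4` comes from the two halvings between `I k` and `I (k + 2)`.
      _ = D ^ q * 4 * (C.K f (x (k + 2)) ^ q * m (I (k + 2))) := by
          rw [show m (I k) = 2 * (2 * m (I (k + 2))) by
            rw [← show m (I (k + 1)) = 2 * m (I (k + 2)) from hhalf (k + 1)]; exact hhalf k,
            show (4 : ℝ≥0∞) = 2 * 2 by norm_num]
          ring
      _ = D ^ q * 4 * ∫⁻ s in I (k + 2), C.K f (x (k + 2)) ^ q ∂m := by rw [setLIntegral_const]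
      _ ≤ _ := by
          refine mul_le_mul_right (setLIntegral_mono' measurableSet_Ioc fun s hs => ?_) _
          exact ENNReal.rpow_le_rpow (C.K_mono f hs.1.le) hq0.le
  have hdisj : Pairwise (Function.onFun Disjoint I) := hx.monotone.pairwise_disjoint_on_Ioc_succ
  have hImeas : ∀ k, MeasurableSet (I k) := fun k => measurableSet_Ioc
  have hsupp : ∫⁻ s, (ENNReal.ofReal (A s) * ENNReal.ofReal (C.J (u s) s)) ^ q ∂logMeasure ≤
      ∫⁻ s in ⋃ k, I k, (ENNReal.ofReal (A s) * ENNReal.ofReal (C.J (u s) s)) ^ q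
        ∂logMeasure := by
    rw [← lintegral_indicator (MeasurableSet.iUnion hImeas)]
    refine lintegral_mono fun s => ?_
    by_cases hs : s ∈ ⋃ k, I k
    · rw [indicator_of_mem hs]
    · rw [indicator_of_notMem hs]
      have hs0 : s ≤ x 0 := by
        by_contra! hlt
        refine hs ?_
        have hex : ∃ k, s ≤ x k := (hxt.eventually_ge_atTop s).exists
        classical
        have hn := Nat.find_spec hex
        have hn0 : Nat.find hex ≠ 0 := fun h0 => by
          rw [h0] at hn; exact absurd hn (not_le.2 hlt)
        obtain ⟨n, hn'⟩ := Nat.exists_eq_succ_of_ne_zero hn0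
        refine mem_iUnion.2 ⟨n, not_le.1 (Nat.find_min hex (by omega)), ?_⟩
        rw [hn'] at hn
        exact hn
      rw [hu_zero s hs0]
      simp [J, hq0]
  have hmain : ∫⁻ s, (ENNReal.ofReal (A s) * ENNReal.ofReal (C.J (u s) s)) ^ q ∂logMeasure ≤
      D ^ q * 4 * ∫⁻ s, (ENNReal.ofReal (B s) * C.K f s) ^ q ∂logMeasure := by
    calc _ ≤ ∑' k, ∫⁻ s in I k, (ENNReal.ofReal (A s) * ENNReal.ofReal (C.J (u s) s)) ^ q
          ∂logMeasure := hsupp.trans (lintegral_iUnion_le _ _)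
      _ ≤ ∑' k, D ^ q * 4 * ∫⁻ s in I (k + 2), C.K f s ^ q ∂m := ENNReal.tsum_le_tsum hpiece
      _ = D ^ q * 4 * ∑' k, ∫⁻ s in I (k + 2), C.K f s ^ q ∂m := ENNReal.tsum_mul_left
      _ ≤ D ^ q * 4 * ∑' k, ∫⁻ s in I k, C.K f s ^ q ∂m :=
          mul_le_mul_right (ENNReal.tsum_comp_le_tsum_of_injective
            (add_left_injective 2) fun k => ∫⁻ s in I k, C.K f s ^ q ∂m) _
      _ = D ^ q * 4 * ∫⁻ s in ⋃ k, I k, C.K f s ^ q ∂m := by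
          rw [lintegral_iUnion hImeas hdisj]
      _ ≤ D ^ q * 4 * ∫⁻ s, C.K f s ^ q ∂m := mul_le_mul_right (setLIntegral_le_lintegral _ _) _
      _ = _ := by
          rw [hm, hB.lintegral_powerMeasure hq0.le]
          simp only [ENNReal.mul_rpow_of_nonneg _ _ hq0.le]
  rw [C.kNorm_eq hq0] at hkt ⊢
  have hN : ∫⁻ s, (ENNReal.ofReal (B s) * C.K f s) ^ q ∂logMeasure ≠ ∞ := by
    intro h'
    rw [h', ENNReal.top_rpow_of_pos hq1] at hkt
    exact hkt rfl
  have hJt := ne_top_of_le_ne_top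
    (ENNReal.mul_ne_top (ENNReal.mul_ne_top hDq ENNReal.ofNat_ne_top) hN) hmain
  have hR := hrep (C.integrableOn_interToSum hB hq hfin hA hum hJt)
  rw [C.jNorm_eq hq0 hA0, ← ENNReal.mul_rpow_of_nonneg _ _ hq1.le]
  exact (iInf₂_le u hR).trans (ENNReal.rpow_le_rpow hmain hq1.le)

end CompatibleCouple

/-! ### Comparison of the `K`-norms, and the theorem -/

theorem coincide_of_le {𝓧 : Type*} {P : 𝓧 → Prop} {M N : 𝓧 → ℝ≥0∞} {c₁ c₂ : ℝ≥0∞}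
    (hc₁ : c₁ ≠ ∞) (hc₂ : c₂ ≠ ∞) (h₁ : ∀ f, M f ≤ c₁ * N f) (h₂ : ∀ f, N f ≤ c₂ * M f) :
    Coincide {f | P f ∧ M f < ∞} M {f | P f ∧ N f < ∞} N := by
  refine ⟨?_, c₁.toReal + c₂.toReal + 1, by positivity, fun f _ => ⟨?_, ?_⟩⟩
  · ext f
    refine and_congr_right fun _ => ⟨fun h => ?_, fun h => ?_⟩
    · exact lt_of_le_of_lt (h₂ f) (ENNReal.mul_lt_top hc₂.lt_top h)
    · exact lt_of_le_of_lt (h₁ f) (ENNReal.mul_lt_top hc₁.lt_top h)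
  · refine (h₁ f).trans (mul_le_mul_left ?_ _)
    refine (ENNReal.le_ofReal_iff_toReal_le hc₁ (by positivity)).2 ?_
    linarith [ENNReal.toReal_nonneg (a := c₂)]
  · refine (h₂ f).trans (mul_le_mul_left ?_ _)
    refine (ENNReal.le_ofReal_iff_toReal_le hc₂ (by positivity)).2 ?_
    linarith [ENNReal.toReal_nonneg (a := c₁)]

namespace SlowlyVarying

variable {B : ℝ → ℝ} {q : ℝ}

/-- `t B(t)` is `O(t ^ (1/2))` near `0`. -/
theorem lintegral_Iic_one_rpow_ne_top (hB : SlowlyVarying B) (hq : 0 < q) :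
    ∫⁻ t in Iic 1, (ENNReal.ofReal (B t) * ENNReal.ofReal t) ^ q ∂logMeasure ≠ ∞ := by
  obtain ⟨d, hd, h⟩ := hB.exists_rpow_mul_le (show (0 : ℝ) < 1 / 2 by norm_num)
  have hB1 := hB.pos 1 (mem_Ioi.2 one_pos)
  rw [setLIntegral_logMeasure measurableSet_Iic, Iic_inter_Ioi]
  have hle : ∫⁻ t in Ioc 0 1, ENNReal.ofReal t⁻¹ * (ENNReal.ofReal (B t) * ENNReal.ofReal t) ^ q ≤
      ∫⁻ t in Ioc 0 1, ENNReal.ofReal ((d * B 1) ^ q) * ENNReal.ofReal (t ^ (q / 2 - 1)) := by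
    refine setLIntegral_mono' measurableSet_Ioc fun t ht => ?_
    have ht0 : 0 < t := ht.1
    have hBt := hB.pos t ht0
    rw [← ENNReal.ofReal_mul hBt.le, ENNReal.ofReal_rpow_of_nonneg (by positivity) hq.le,
      ← ENNReal.ofReal_mul (by positivity), ← ENNReal.ofReal_mul (by positivity)]
    refine ENNReal.ofReal_le_ofReal ?_
    have h1 := h t 1 ht0 ht.2
    rw [Real.one_rpow, one_mul] at h1
    have h2 : B t * t ≤ d * B 1 * t ^ (1 / 2 : ℝ) := by
      calc B t * t = (t ^ (1 / 2 : ℝ) * B t) * t ^ (1 / 2 : ℝ) := by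
            rw [mul_right_comm, ← Real.rpow_add ht0]; norm_num [mul_comm]
        _ ≤ _ := by gcongr
    calc t⁻¹ * (B t * t) ^ q ≤ t⁻¹ * (d * B 1 * t ^ (1 / 2 : ℝ)) ^ q := by gcongr
      _ = (d * B 1) ^ q * t ^ (q / 2 - 1) := by
        rw [Real.mul_rpow (by positivity) (by positivity), ← Real.rpow_mul ht0.le,
          Real.rpow_sub_one ht0.ne', show 1 / 2 * q = q / 2 by ring]
        ring
  refine ne_top_of_le_ne_top ?_ hle
  rw [lintegral_const_mul' _ _ ENNReal.ofReal_ne_top, lintegral_rpow_Ioc (by linarith) zero_le_one]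
  exact ENNReal.mul_ne_top ENNReal.ofReal_ne_top ENNReal.ofReal_ne_top

theorem powerMeasure_Ioi_ne_top (hB : SlowlyVarying B) (hq : 0 < q)
    (h1 : powerMeasure B q (Ioi 1) ≠ ∞) {x : ℝ} (hx : 0 < x) : powerMeasure B q (Ioi x) ≠ ∞ := by
  have hsub : Ioi x ⊆ Ioc x 1 ∪ Ioi 1 := fun t ht => by
    rcases le_or_gt t 1 with h | h
    · exact Or.inl ⟨ht, h⟩
    · exact Or.inr h
  refine ne_top_of_le_ne_top ?_ ((measure_mono hsub).trans (measure_union_le _ _))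
  refine ENNReal.add_ne_top.2 ⟨?_, h1⟩
  rw [powerMeasure, withDensity_apply _ measurableSet_Ioc]
  have hxq : ENNReal.ofReal x⁻¹ ^ q ≠ ∞ := ENNReal.rpow_ne_top_of_nonneg hq.le ENNReal.ofReal_ne_top
  refine ne_top_of_le_ne_top (ENNReal.mul_ne_top hxq (hB.lintegral_Iic_one_rpow_ne_top hq)) ?_
  rw [← lintegral_const_mul' _ _ hxq]
  refine (setLIntegral_mono' measurableSet_Ioc fun t ht => ?_).trans
    (lintegral_mono_set Ioc_subset_Iic_self)
  rw [← ENNReal.mul_rpow_of_nonneg _ _ hq.le]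
  refine ENNReal.rpow_le_rpow ?_ hq.le
  calc ENNReal.ofReal (B t) = ENNReal.ofReal (B t) * 1 := (mul_one _).symm
    _ ≤ ENNReal.ofReal (B t) * (ENNReal.ofReal x⁻¹ * ENNReal.ofReal t) := by
        gcongr
        rw [← ENNReal.ofReal_mul (by positivity), ← ENNReal.ofReal_one]
        refine ENNReal.ofReal_le_ofReal ?_
        rw [inv_mul_eq_div, one_le_div hx]
        exact ht.1.le
    _ = _ := by ring

end SlowlyVarying

namespace CompatibleCouple

variable {𝕜 X₀ X₁ 𝓧 : Type*} [RCLike 𝕜]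
  [NormedAddCommGroup X₀] [NormedSpace 𝕜 X₀] [NormedAddCommGroup X₁] [NormedSpace 𝕜 X₁]
  [AddCommGroup 𝓧] [Module 𝕜 𝓧] [TopologicalSpace 𝓧] [IsTopologicalAddGroup 𝓧] [T2Space 𝓧]
  (C : CompatibleCouple 𝕜 X₀ X₁ 𝓧) {q : ℝ} {b B : ℝ → ℝ}

/-- `X₀ ⊆ X₀ + X₁`, so that the couple `(X₀, X₀ + X₁)` is ordered. -/
theorem withSum_incl (x : X₀) (y : C.SumSpace) :
    ∃ z, C.withSum.i₁ z = C.withSum.i₀ x + C.withSum.i₁ y ∧ ‖z‖ ≤ ‖x‖ + ‖y‖ := by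
  refine ⟨C.toSum₀ x + y, ?_, ?_⟩
  · simp only [withSum, map_add, sumEmb_toSum₀]
  · exact (norm_add_le _ _).trans (by gcongr; exact C.norm_toSum₀_le x)

/-- The `K`-norms for `(X₀, X₁)` with weight `b` and for `(X₀, X₀ + X₁)` with weight `B` agree up to
constants: both are determined by the part over `(1,∞)`. -/
theorem exists_kNorm_withSum_equiv (hb : SlowlyVarying b) (hB : SlowlyVarying B) (hq : 1 ≤ q)
    (hb_fin : powerMeasure b q univ ≠ ∞) (hbB : ∀ t, 1 ≤ t → B t = b t) :
    (∃ c : ℝ≥0∞, c ≠ ∞ ∧ ∀ f : 𝓧, C.kNorm 0 (ENNReal.ofReal q) b f ≤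
      c * C.withSum.kNorm 0 (ENNReal.ofReal q) B f) ∧
    ∃ c : ℝ≥0∞, c ≠ ∞ ∧ ∀ f : 𝓧, C.withSum.kNorm 0 (ENNReal.ofReal q) B f ≤
      c * C.kNorm 0 (ENNReal.ofReal q) b f := by
  have hq0 : 0 < q := by linarith
  have hq1 : 0 < 1 / q := by positivity
  set S := ∫⁻ t in Iic 1, (ENNReal.ofReal (B t) * ENNReal.ofReal t) ^ q ∂logMeasure with hS
  have hSt : S ≠ ∞ := hB.lintegral_Iic_one_rpow_ne_top hq0
  set μ := powerMeasure b q (Ioi 1) with hμ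
  have hμ0 : μ ≠ 0 := hb.powerMeasure_Ioi_ne_zero hq0.le 1
  have hμt : μ ≠ ∞ := ne_top_of_le_ne_top hb_fin (measure_mono (subset_univ _))
  set E : 𝓧 → ℝ≥0∞ := fun f => ∫⁻ t in Ioi 1, (ENNReal.ofReal (b t) * C.K f t) ^ q ∂logMeasure
    with hE
  have hEB : ∀ f,
      ∫⁻ t in Ioi 1, (ENNReal.ofReal (B t) * C.withSum.K f t) ^ q ∂logMeasure = E f := by
    intro f
    refine setLIntegral_congr_fun measurableSet_Ioi fun t ht => ?_
    have ht1 : 1 ≤ t := le_of_lt ht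
    simp only [C.withSum_K_eq f ht1, hbB t ht1]
  have hK1 : ∀ f, C.K f 1 ^ q ≤ μ⁻¹ * E f := by
    intro f
    rw [← ENNReal.div_eq_inv_mul, ENNReal.le_div_iff_mul_le (Or.inl hμ0) (Or.inl hμt)]
    rw [hμ, powerMeasure, withDensity_apply _ measurableSet_Ioi]
    refine (lintegral_const_mul_le _ _).trans ?_
    refine setLIntegral_mono' measurableSet_Ioi fun t ht => ?_
    rw [ENNReal.mul_rpow_of_nonneg _ _ hq0.le, mul_comm]
    gcongr
    exact C.K_mono f (le_of_lt ht)
  have hlow : ∀ f, ∫⁻ t in Iic 1, (ENNReal.ofReal (b t) * C.K f t) ^ q ∂logMeasure ≤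
      powerMeasure b q univ * C.K f 1 ^ q := by
    intro f
    calc _ ≤ ∫⁻ t in Iic 1, ENNReal.ofReal (b t) ^ q * C.K f 1 ^ q ∂logMeasure := by
          refine setLIntegral_mono' measurableSet_Iic fun t ht => ?_
          rw [ENNReal.mul_rpow_of_nonneg _ _ hq0.le]
          gcongr
          exact C.K_mono f ht
      _ ≤ ∫⁻ t, ENNReal.ofReal (b t) ^ q * C.K f 1 ^ q ∂logMeasure := setLIntegral_le_lintegral _ _
      _ = _ := by rw [← hb.lintegral_powerMeasure hq0.le, lintegral_const, mul_comm]
  have hlow' : ∀ f, ∫⁻ t in Iic 1, (ENNReal.ofReal (B t) * C.withSum.K f t) ^ q ∂logMeasure ≤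
      S * C.K f 1 ^ q := by
    intro f
    have hmeas : AEMeasurable (fun t => (ENNReal.ofReal (B t) * ENNReal.ofReal t) ^ q)
        (logMeasure.restrict (Iic 1)) :=
      ((hB.aemeasurable_logMeasure.ennreal_ofReal.mul
        ENNReal.measurable_ofReal.aemeasurable).pow_const _).restrict
    rw [hS, ← lintegral_mul_const'' _ hmeas]
    refine lintegral_mono_ae ?_
    filter_upwards [ae_restrict_of_ae ae_logMeasure_pos] with t ht
    rw [← ENNReal.mul_rpow_of_nonneg _ _ hq0.le, mul_assoc]
    gcongr
    exact C.withSum_K_le_mul f ht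
  have htotal : ∀ (F : ℝ → ℝ≥0∞) (L c e : ℝ≥0∞), ∫⁻ t in Iic 1, F t ∂logMeasure ≤ L * c →
      c ≤ μ⁻¹ * e → ∫⁻ t in Ioi 1, F t ∂logMeasure = e →
      ∫⁻ t, F t ∂logMeasure ≤ (L * μ⁻¹ + 1) * e := by
    intro F L c e h₁ h₂ h₃
    rw [← lintegral_add_compl F (measurableSet_Iic (a := (1 : ℝ))), compl_Iic, h₃, add_mul, one_mul,
      mul_assoc]
    gcongr
    exact h₁.trans (by gcongr)
  have hconst : ∀ L : ℝ≥0∞, L ≠ ∞ → (L * μ⁻¹ + 1) ^ (1 / q) ≠ ∞ := fun L hL =>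
    ENNReal.rpow_ne_top_of_nonneg hq1.le (ENNReal.add_ne_top.2
      ⟨ENNReal.mul_ne_top hL (ENNReal.inv_ne_top.2 hμ0), ENNReal.one_ne_top⟩)
  refine ⟨⟨_, hconst _ hb_fin, fun f => ?_⟩, ⟨_, hconst _ hSt, fun f => ?_⟩⟩
  · rw [C.kNorm_eq hq0, C.withSum.kNorm_eq hq0, ← ENNReal.mul_rpow_of_nonneg _ _ hq1.le]
    refine ENNReal.rpow_le_rpow ((htotal _ _ _ _ (hlow f) (hK1 f) rfl).trans ?_) hq1.le
    refine mul_le_mul_right ?_ _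
    rw [← hEB]
    exact setLIntegral_le_lintegral _ _
  · rw [C.kNorm_eq hq0, C.withSum.kNorm_eq hq0, ← ENNReal.mul_rpow_of_nonneg _ _ hq1.le]
    refine ENNReal.rpow_le_rpow ((htotal _ _ _ _ (hlow' f) (hK1 f) (hEB f)).trans ?_) hq1.le
    exact mul_le_mul_right (setLIntegral_le_lintegral _ _) _

end CompatibleCouple

theorem theorem1p7 {𝕜 X₀ X₁ 𝓧 : Type*} [RCLike 𝕜]
    [NormedAddCommGroup X₀] [NormedSpace 𝕜 X₀] [CompleteSpace X₀]
    [NormedAddCommGroup X₁] [NormedSpace 𝕜 X₁] [CompleteSpace X₁]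
    [AddCommGroup 𝓧] [Module 𝕜 𝓧] [TopologicalSpace 𝓧] [IsTopologicalAddGroup 𝓧]
    [ContinuousSMul 𝕜 𝓧] [T2Space 𝓧]
    (C : CompatibleCouple 𝕜 X₀ X₁ 𝓧) (q : ℝ) (hq : 1 ≤ q) (b β B A : ℝ → ℝ)
    (hb : SlowlyVarying b)
    (hb_int : ∫⁻ t in Ioi (0 : ℝ), ENNReal.ofReal (t⁻¹ * b t ^ q) < ∞)
    (hβ : SlowlyVarying β)
    (hβ_tail : ∀ x : ℝ, 0 < x → ∫⁻ t in Ioi x, ENNReal.ofReal (t⁻¹ * β t ^ q) < ∞)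
    (hβ_int : ∫⁻ t in Ioi (0 : ℝ), ENNReal.ofReal (t⁻¹ * β t ^ q) = ∞)
    (hB : SlowlyVarying B)
    (hB_b : ∀ x ∈ Ici (1 : ℝ), B x = b x)
    (hB_β : EquivOn B β (Ioo 0 1))
    -- `1 - 1 / q` is `1 / q'`, so that the exponent is `-q/q'` (and `0` if `q = 1`, `q' = ∞`)
    (hA : ∀ x : ℝ, 0 < x → A x = B x ^ (-(q * (1 - 1 / q))) * ∫ t in Ioi x, t⁻¹ * B t ^ q) :
    Coincide (C.kSpace 0 (ENNReal.ofReal q) b) (C.kNorm 0 (ENNReal.ofReal q) b)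
        (C.withSum.kSpace 0 (ENNReal.ofReal q) B) (C.withSum.kNorm 0 (ENNReal.ofReal q) B) ∧
      Coincide (C.withSum.kSpace 0 (ENNReal.ofReal q) B) (C.withSum.kNorm 0 (ENNReal.ofReal q) B)
        (C.withSum.jSpace 0 (ENNReal.ofReal q) A) (C.withSum.jNorm 0 (ENNReal.ofReal q) A) := by
  have hq0 : 0 < q := by linarith
  have huniv : powerMeasure b q univ = powerMeasure b q (Ioi 0) :=
    (measure_eq_measure_of_null_sdiff (subset_univ _) (by
      rw [← compl_eq_univ_sdiff]; exact ae_powerMeasure_pos)).symm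
  have hb_fin : powerMeasure b q univ ≠ ∞ := by
    rw [huniv, hb.powerMeasure_apply hq0.le measurableSet_Ioi subset_rfl]
    exact hb_int.ne
  have hB1 : powerMeasure B q (Ioi 1) ≠ ∞ := by
    have hsub : Ioi (1 : ℝ) ⊆ Ioi 0 := Ioi_subset_Ioi zero_le_one
    rw [hB.powerMeasure_apply hq0.le measurableSet_Ioi hsub]
    have hcongr : EqOn (fun t => ENNReal.ofReal (t⁻¹ * B t ^ q))
        (fun t => ENNReal.ofReal (t⁻¹ * b t ^ q)) (Ioi 1) := fun t ht => by
      simp only [hB_b t (mem_Ici.2 (le_of_lt ht))]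
    rw [setLIntegral_congr_fun measurableSet_Ioi hcongr]
    exact ((lintegral_mono_set hsub).trans_lt hb_int).ne
  have hfin : ∀ x, 0 < x → powerMeasure B q (Ioi x) ≠ ∞ := fun x hx =>
    hB.powerMeasure_Ioi_ne_top hq0 hB1 hx
  have hΦ : ∀ x, 0 < x → ∫ t in Ioi x, t⁻¹ * B t ^ q = (powerMeasure B q (Ioi x)).toReal := by
    intro x hx
    have hsub : Ioi x ⊆ Ioi 0 := Ioi_subset_Ioi hx.le
    rw [hB.powerMeasure_apply hq0.le measurableSet_Ioi hsub, integral_eq_lintegral_of_nonneg_ae]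
    · filter_upwards [ae_restrict_mem measurableSet_Ioi] with t ht
      have ht0 : 0 < t := hsub ht
      have := hB.pos t ht0
      positivity
    · exact ((measurable_inv.aemeasurable.mul (hB.measurable.pow_const q)).mono_measure
        (Measure.restrict_mono hsub le_rfl)).aestronglyMeasurable
  have hexp : -(q * (1 - 1 / q)) = 1 - q := by field_simp; ring
  have hA0 : ∀ x, 0 < x → 0 ≤ A x := fun x hx => by
    rw [hA x hx, hΦ x hx]
    exact mul_nonneg (Real.rpow_nonneg (hB.pos x hx).le _) ENNReal.toReal_nonneg
  have hA' : ∀ x, 0 < x → ENNReal.ofReal (A x) =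
      ENNReal.ofReal (B x) ^ (1 - q) * powerMeasure B q (Ioi x) := fun x hx => by
    rw [hA x hx, hΦ x hx, hexp, ENNReal.ofReal_mul (Real.rpow_nonneg (hB.pos x hx).le _),
      ENNReal.ofReal_toReal (hfin x hx), ENNReal.ofReal_rpow_of_pos (hB.pos x hx)]
  constructor
  · obtain ⟨⟨c₁, hc₁, h₁⟩, c₂, hc₂, h₂⟩ := C.exists_kNorm_withSum_equiv hb hB hq hb_fin hB_b
    rw [CompatibleCouple.kSpace, CompatibleCouple.kSpace, C.withSum_sumSubmodule]
    exact coincide_of_le hc₁ hc₂ h₁ h₂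
  · obtain ⟨c₁, hc₁, h₁⟩ := C.withSum.exists_kNorm_le_jNorm hB hq hfin hA0 hA'
    obtain ⟨c₂, hc₂, h₂⟩ := C.withSum.exists_jNorm_le_kNorm hB hq hfin hA0 hA' C.withSum_incl
    exact coincide_of_le hc₁ hc₂ h₁ h₂
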